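/- Let $M$ be a smooth ($C^\infty$, Hausdorff, $\sigma$-compact, without boundary) manifold of dimension $n$, let $g$ be a continuous Lorentzian metric on $M$ (signature $(-,+,\dots,+)$) such that $(M,g)$ admits a continuous timelike vector field, i.e. is time-orientable, and let $h$ be a smooth Riemannian metric on $M$. For Lorentzian metrics $g_1,g_2$ write $g_1\prec g_2$ if every tangent vector $X\neq 0$ with $g_1(X,X)\le 0$ satisfies $g_2(X,X)<0$, and for symmetric $(0,2)$-tensor fields $g_1,g_2$ put $$d_h(g_1,g_2):=\sup_{p\in M}\ \sup_{0\ne X,Y\in T_pM}\frac{|g_1(X,Y)-g_2(X,Y)|}{\|X\|_h\,\|Y\|_h}\in[0,\infty].$$ Then there are families $(\check g_\varepsilon)_{\varepsilon>0}$ and $(\hat g_\varepsilon)_{\varepsilon>0}$ of smooth Lorentzian metrics on $M$ such that: (a) for every $\varepsilon>0$, $\ \check g_\varepsilon\prec g\prec\hat g_\varepsilon$ and $d_h(\check g_\varepsilon,g)+d_h(\hat g_\varepsilon,g)<\varepsilon$; (b) $\check g_\varepsilon$ and $\hat g_\varepsilon$ depend smoothly on $\varepsilon$, i.e. the maps $(\varepsilon,p)\mapsto\check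 g_\varepsilon(p)$ and $(\varepsilon,p)\mapsto\hat g_\varepsilon(p)$ from $(0,\infty)\times M$ to the bundle $T^0_2M$ of $(0,2)$-tensors are smooth; (c) if moreover $g$ is of class $C^{1,1}$ (in every smooth chart its components are $C^1$ with locally Lipschitz first derivatives), then, for both $g_\varepsilon=\check g_\varepsilon$ and $g_\varepsilon=\hat g_\varepsilon$: (i) $g_\varepsilon\to g$ in the $C^1$-topology as $\varepsilon\to0$, i.e. in every smooth chart the components of $g_\varepsilon$ and their first derivatives converge to those of $g$ uniformly on compact subsets of the chart; and (ii) in every smooth chart the second derivatives of the components of $g_\varepsilon$ are bounded on each compact subset of the chart, uniformly in $\varepsilon>0$. -/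

import Mathlib

open Set Filter Topology Bundle
open scoped Manifold ContDiff ENNReal

noncomputable section

namespace LorentzApprox

/-- The model space `ℝⁿ`. -/
abbrev E (n : ℕ) : Type := EuclideanSpace ℝ (Fin n)

variable {n : ℕ} {M : Type*} [TopologicalSpace M] [ChartedSpace (E n) M]

/-- The fibre of `T⁰₂ M` at `p`: bilinear forms on the tangent space `T_p M`. -/
abbrev BilinAt (n : ℕ) {M : Type*} [TopologicalSpace M] [ChartedSpace (E n) M] (p : M) : Type :=
  TangentSpace (𝓡 n) p →L[ℝ] TangentSpace (𝓡 n) p →L[ℝ] ℝ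

/-- `(0,2)`-tensor fields on `M`, with no regularity imposed. -/
abbrev TensorField (n : ℕ) (M : Type*) [TopologicalSpace M] [ChartedSpace (E n) M] : Type _ :=
  ∀ p : M, BilinAt n p

/-- The tensor field `g` is continuous, as a map from `M` to the total space of `T⁰₂ M`. -/
def TensorField.IsContinuous [IsManifold (𝓡 n) ∞ M] (g : TensorField n M) : Prop :=
  Continuous (fun p : M =>
    (TotalSpace.mk' (E n →L[ℝ] E n →L[ℝ] ℝ) p (g p) :
      TotalSpace (E n →L[ℝ] E n →L[ℝ] ℝ) (fun p : M => BilinAt n p)))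

/-- The tensor field `g` is smooth, as a map from `M` to the total space of `T⁰₂ M`. -/
def TensorField.IsSmooth [IsManifold (𝓡 n) ∞ M] (g : TensorField n M) : Prop :=
  ContMDiff (𝓡 n) ((𝓡 n).prod 𝓘(ℝ, E n →L[ℝ] E n →L[ℝ] ℝ)) ∞ (fun p : M =>
    (TotalSpace.mk' (E n →L[ℝ] E n →L[ℝ] ℝ) p (g p) :
      TotalSpace (E n →L[ℝ] E n →L[ℝ] ℝ) (fun p : M => BilinAt n p)))

/-- The family `(g_ε)` depends smoothly on `ε > 0`: the map `(ε, p) ↦ g_ε(p)` from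
`(0, ∞) × M` to the total space of `T⁰₂ M` is smooth. -/
def SmoothFamily [IsManifold (𝓡 n) ∞ M] (g : ℝ → TensorField n M) : Prop :=
  ContMDiffOn (𝓘(ℝ, ℝ).prod (𝓡 n)) ((𝓡 n).prod 𝓘(ℝ, E n →L[ℝ] E n →L[ℝ] ℝ)) ∞
    (fun q : ℝ × M =>
      (TotalSpace.mk' (E n →L[ℝ] E n →L[ℝ] ℝ) q.2 (g q.1 q.2) :
        TotalSpace (E n →L[ℝ] E n →L[ℝ] ℝ) (fun p : M => BilinAt n p)))
    (Ioi (0 : ℝ) ×ˢ (univ : Set M))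

/-- `g` is pointwise symmetric of signature `(-,+,…,+)`: at each point there is a vector `v` with
`g(v,v) < 0` on whose `g`-orthogonal complement (a complement of `ℝ v`) `g` is positive definite. -/
def TensorField.IsLorentzian (g : TensorField n M) : Prop :=
  ∀ p : M, (∀ X Y : TangentSpace (𝓡 n) p, g p X Y = g p Y X) ∧
    ∃ v : TangentSpace (𝓡 n) p, g p v v < 0 ∧
      ∀ w : TangentSpace (𝓡 n) p, w ≠ 0 → g p v w = 0 → 0 < g p w w

/-- There is a continuous `g`-timelike vector field on `M`. -/
def TensorField.TimeOrientable [IsManifold (𝓡 n) ∞ M] (g : TensorField n M) : Prop :=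
  ∃ X : ∀ p : M, TangentSpace (𝓡 n) p,
    Continuous (fun p : M => (⟨p, X p⟩ : TangentBundle (𝓡 n) M)) ∧ ∀ p : M, g p (X p) (X p) < 0

/-- `g₁ ≺ g₂`: the metric `g₂` has strictly larger light cones than `g₁`. -/
def StrictlyLargerCones (g₁ g₂ : TensorField n M) : Prop :=
  ∀ (p : M) (X : TangentSpace (𝓡 n) p), X ≠ 0 → g₁ p X X ≤ 0 → g₂ p X X < 0

/-- The distance of `g₁` and `g₂` with respect to the Riemannian metric `h`: the supremum of
`|g₁(X,Y) - g₂(X,Y)| / (‖X‖_h ‖Y‖_h)` over nonzero tangent vectors `X, Y` at a common point. -/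
def distWrt [IsManifold (𝓡 n) ∞ M]
    (h : ContMDiffRiemannianMetric (𝓡 n) ∞ (E n) (fun p : M => TangentSpace (𝓡 n) p))
    (g₁ g₂ : TensorField n M) : ℝ≥0∞ :=
  ⨆ (p : M) (X : TangentSpace (𝓡 n) p) (Y : TangentSpace (𝓡 n) p) (_ : X ≠ 0) (_ : Y ≠ 0),
    ENNReal.ofReal
      (|g₁ p X Y - g₂ p X Y| / (Real.sqrt (h.inner p X X) * Real.sqrt (h.inner p Y Y)))

/-- The component `g(∂ᵢ, ∂ⱼ)` of `g` in the chart `φ`, as a function on `φ.target ⊆ ℝⁿ`. -/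
def component (g : TensorField n M) (φ : OpenPartialHomeomorph M (E n)) (i j : Fin n) (x : E n) :
    ℝ :=
  g (φ.symm x)
    (mfderiv (𝓡 n) (𝓡 n) φ.symm x (EuclideanSpace.single i (1 : ℝ) : E n))
    (mfderiv (𝓡 n) (𝓡 n) φ.symm x (EuclideanSpace.single j (1 : ℝ) : E n))

/-- `g` is of class `C^{1,1}`: in each smooth chart its components are continuously differentiable
with locally Lipschitz first derivatives. -/
def TensorField.IsC11 (g : TensorField n M) : Prop :=
  ∀ φ ∈ IsManifold.maximalAtlas (𝓡 n) ∞ M, ∀ i j : Fin n,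
    ContDiffOn ℝ 1 (component g φ i j) φ.target ∧
      LocallyLipschitzOn φ.target (fderiv ℝ (component g φ i j))

/-- `g_ε → g` as `ε → 0⁺` in the (compact-open) `C¹`-topology: in each smooth chart the components
and their first derivatives converge uniformly on compact sets. -/
def ConvergesC1 (gε : ℝ → TensorField n M) (g : TensorField n M) : Prop :=
  ∀ φ ∈ IsManifold.maximalAtlas (𝓡 n) ∞ M, ∀ K : Set (E n), IsCompact K → K ⊆ φ.target →
    ∀ i j : Fin n,
      TendstoUniformlyOn (fun ε => component (gε ε) φ i j) (component g φ i j) (𝓝[>] 0) K ∧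
      TendstoUniformlyOn (fun ε => fderiv ℝ (component (gε ε) φ i j))
        (fderiv ℝ (component g φ i j)) (𝓝[>] 0) K

/-- The second derivatives of `g_ε` are bounded on compact sets, uniformly in `ε > 0`. -/
def SecondDerivBounded (gε : ℝ → TensorField n M) : Prop :=
  ∀ φ ∈ IsManifold.maximalAtlas (𝓡 n) ∞ M, ∀ K : Set (E n), IsCompact K → K ⊆ φ.target →
    ∃ C : ℝ, ∀ ε : ℝ, 0 < ε → ∀ x ∈ K, ∀ i j : Fin n,
      ‖iteratedFDeriv ℝ 2 (component (gε ε) φ i j) x‖ ≤ C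

end LorentzApprox

end

/-!
Let `θ = g(T, ·)` for a `g`-timelike vector `T`, extended as a constant covector in a chart.
Near the base point `g + K θ²` is positive definite for some `K > 0`, so `θ² > 0` on the causal
vectors of `g` and adding a small positive (negative) multiple of `θ²` to `g` strictly narrows
(widens) its light cones. This survives a perturbation that is small compared with that
multiple, hence `g` may be replaced by a mollification with a much smaller parameter. The
requirements on the resulting form are convex at each point, once being Lorentzian is sharpened
to lying in a ball around `g` that contains only Lorentzian forms. Therefore the local metrics
may be glued by a partition of unity, and the sequence obtained for the errors `1 / (k + 1)` may
be interpolated smoothly in `ε`. If `g` is `C^{1,1}`, then mollifying with parameter at most `δ`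
changes it by `O(δ)` in `C^1` and keeps the second derivatives below the Lipschitz constant of
the first ones; both bounds are preserved under the gluing and the interpolation.
-/

noncomputable section

namespace LorentzApprox

-- The instances on `V →L[ℝ] V →L[ℝ] ℝ` need nested synthesis.
set_option maxSynthPendingDepth 3

section Mollification

open MeasureTheory Metric ContinuousLinearMap
open scoped Convolution NNReal

variable {V W W' : Type*} [NormedAddCommGroup V] [NormedSpace ℝ V] [FiniteDimensional ℝ V]
  [MeasurableSpace V] [NormedAddCommGroup W] [NormedSpace ℝ W]
  [NormedAddCommGroup W'] [NormedSpace ℝ W'] {μ : Measure V}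
  {ρ : ContDiffBump (0 : V)} {G : V → W} {L : ℝ≥0} {s : Set V}

/-- The mollification of `G` by the bump function `ρ`, normalized to have integral `1`. -/
def mollify (μ : Measure V) (ρ : ContDiffBump (0 : V)) (G : V → W) : V → W :=
  ρ.normed μ ⋆[lsmul ℝ ℝ, μ] G

theorem mollify_apply (x : V) : mollify μ ρ G x = ∫ t, ρ.normed μ t • G (x - t) ∂μ := rfl

variable [BorelSpace V] [μ.IsAddHaarMeasure]

theorem integrable_mollify (hG : Continuous G) (x : V) :
    Integrable (fun t => ρ.normed μ t • G (x - t)) μ :=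
  ρ.hasCompactSupport_normed.convolutionExists_left (lsmul ℝ ℝ)
    (ρ.contDiff_normed (n := 0)).continuous hG.locallyIntegrable x

theorem contDiff_mollify (hG : Continuous G) : ContDiff ℝ ∞ (mollify μ ρ G) :=
  ρ.hasCompactSupport_normed.contDiff_convolution_left _ ρ.contDiff_normed hG.locallyIntegrable

theorem clm_mollify [CompleteSpace W] [CompleteSpace W'] (A : W →L[ℝ] W') (hG : Continuous G)
    (x : V) : A (mollify μ ρ G x) = mollify μ ρ (fun y => A (G y)) x := by
  simp only [mollify_apply, ← A.map_smul]
  exact (A.integral_comp_comm (integrable_mollify hG x)).symm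

theorem fderiv_mollify (hG : ContDiff ℝ 1 G) (hsupp : HasCompactSupport G) :
    fderiv ℝ (mollify μ ρ G) = mollify μ ρ (fderiv ℝ G) := by
  ext1 x
  exact (hsupp.hasFDerivAt_convolution_right (lsmul ℝ ℝ)
    (ρ.integrable_normed (μ := μ)).locallyIntegrable hG x).fderiv

theorem norm_mollify_sub_le [CompleteSpace W] (hG : Continuous G) {x : V} {ε : ℝ}
    (hε : ∀ y ∈ ball x ρ.rOut, dist (G y) (G x) ≤ ε) : ‖mollify μ ρ G x - G x‖ ≤ ε := by
  rw [← dist_eq_norm]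
  exact ρ.dist_normed_convolution_le hG.aestronglyMeasurable hε

theorem norm_mollify_sub_le_of_lipschitzOnWith [CompleteSpace W] (hG : Continuous G)
    (hL : LipschitzOnWith L G (thickening ρ.rOut s)) {x : V} (hx : x ∈ s) :
    ‖mollify μ ρ G x - G x‖ ≤ L * ρ.rOut :=
  norm_mollify_sub_le hG fun y hy =>
    (hL.dist_le_mul y (ball_subset_thickening hx _ hy) x
      (self_subset_thickening ρ.rOut_pos s hx)).trans
      (mul_le_mul_of_nonneg_left (mem_ball.1 hy).le L.coe_nonneg)

theorem lipschitzOnWith_mollify [CompleteSpace W] (hG : Continuous G)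
    (hL : LipschitzOnWith L G (thickening ρ.rOut s)) : LipschitzOnWith L (mollify μ ρ G) s := by
  refine LipschitzOnWith.of_dist_le_mul fun x hx y hy => ?_
  set D : V → W := fun z => G z - G (z - (x - y)) with hD
  have hDc : Continuous D := by fun_prop
  have hsub : mollify μ ρ G x - mollify μ ρ G y = mollify μ ρ D x := by
    simp only [mollify_apply, hD, smul_sub, show ∀ t, x - t - (x - y) = y - t from fun t => by abel]
    exact (integral_sub (integrable_mollify hG x) (integrable_mollify hG y)).symm
  rw [dist_eq_norm, hsub, ← dist_zero_right]
  refine dist_convolution_le (by positivity) ρ.support_normed_eq.subset ρ.nonneg_normed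
    ρ.integral_normed hDc.aestronglyMeasurable fun z hz => ?_
  have hz' : z - (x - y) ∈ ball y ρ.rOut := by
    rw [mem_ball_iff_norm] at hz ⊢
    convert hz using 2
    abel
  calc dist (D z) 0 = dist (G z) (G (z - (x - y))) := by rw [dist_zero_right, dist_eq_norm]
    _ ≤ L * dist z (z - (x - y)) := hL.dist_le_mul z (ball_subset_thickening hx _ hz) _
        (ball_subset_thickening hy _ hz')
    _ = L * dist x y := by rw [dist_eq_norm, dist_eq_norm, sub_sub_cancel]

theorem exists_norm_mollify_sub_le [CompleteSpace W] (μ : Measure V) [μ.IsAddHaarMeasure]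
    (hG : Continuous G) (hsupp : HasCompactSupport G) {δ η : ℝ} (hδ : 0 < δ) (hη : 0 < η) :
    ∃ ρ : ContDiffBump (0 : V), ρ.rOut ≤ η ∧ ∀ x, ‖mollify μ ρ G x - G x‖ ≤ δ := by
  obtain ⟨τ, hτ, hunif⟩ := Metric.uniformContinuous_iff.1
    (hsupp.uniformContinuous_of_continuous hG) δ hδ
  have hmin : 0 < min τ η := lt_min hτ hη
  refine ⟨⟨min τ η / 2, min τ η, half_pos hmin, half_lt_self hmin⟩, min_le_right _ _, fun x => ?_⟩
  exact norm_mollify_sub_le hG fun y hy => (hunif ((mem_ball.1 hy).trans_le (min_le_left _ _))).le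

end Mollification

section Pointwise

variable {V V' W W' : Type*} [NormedAddCommGroup V] [NormedSpace ℝ V]
  [NormedAddCommGroup V'] [NormedSpace ℝ V'] [NormedAddCommGroup W] [NormedSpace ℝ W]
  [NormedAddCommGroup W'] [NormedSpace ℝ W'] {m : ℕ} {x : V}

theorem exists_isOpen_contDiffOn {f : V → W} (hf : ContDiffAt ℝ m f x) :
    ∃ s, IsOpen s ∧ x ∈ s ∧ ContDiffOn ℝ m f s := by
  obtain ⟨s, hs, hso, hxs⟩ := eventually_nhds_iff.1 (hf.eventually (by simp))
  exact ⟨s, hso, hxs, fun y hy => (hs y hy).contDiffWithinAt⟩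

theorem norm_iteratedFDeriv_comp_le_of_contDiffAt {u : V' → W} {ψ : V → V'}
    (hu : ContDiffAt ℝ m u (ψ x)) (hψ : ContDiffAt ℝ m ψ x) {C D : ℝ}
    (hC : ∀ j ≤ m, ‖iteratedFDeriv ℝ j u (ψ x)‖ ≤ C)
    (hD : ∀ j, 1 ≤ j → j ≤ m → ‖iteratedFDeriv ℝ j ψ x‖ ≤ D ^ j) :
    ‖iteratedFDeriv ℝ m (fun y => u (ψ y)) x‖ ≤ m.factorial * C * D ^ m := by
  obtain ⟨t, hto, hxt, hut⟩ := exists_isOpen_contDiffOn hu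
  obtain ⟨s, hso, hxs, hψs⟩ := exists_isOpen_contDiffOn hψ
  have hopen : IsOpen (s ∩ ψ ⁻¹' t) := hψs.continuousOn.isOpen_inter_preimage hso hto
  have hx : x ∈ s ∩ ψ ⁻¹' t := ⟨hxs, hxt⟩
  rw [← iteratedFDerivWithin_of_isOpen m hopen hx]
  refine norm_iteratedFDerivWithin_comp_le hut (hψs.mono inter_subset_left) le_rfl hto.uniqueDiffOn
    hopen.uniqueDiffOn (fun y hy => hy.2) hx (fun j hj => ?_) (fun j hj₁ hj => ?_)
  · rw [iteratedFDerivWithin_of_isOpen j hto hxt]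
    exact hC j hj
  · rw [iteratedFDerivWithin_of_isOpen j hopen hx]
    exact hD j hj₁ hj

theorem norm_iteratedFDeriv_clm_apply_of_contDiffAt {a : V → W →L[ℝ] W'} {u : V → W}
    (ha : ContDiffAt ℝ m a x) (hu : ContDiffAt ℝ m u x) :
    ‖iteratedFDeriv ℝ m (fun y => a y (u y)) x‖ ≤ ∑ i ∈ Finset.range (m + 1),
      (m.choose i : ℝ) * ‖iteratedFDeriv ℝ i a x‖ * ‖iteratedFDeriv ℝ (m - i) u x‖ := by
  obtain ⟨s, hso, hxs, has⟩ := exists_isOpen_contDiffOn ha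
  obtain ⟨t, hto, hxt, hut⟩ := exists_isOpen_contDiffOn hu
  have hopen := hso.inter hto
  have hbound := norm_iteratedFDerivWithin_clm_apply (has.mono inter_subset_left)
    (hut.mono inter_subset_right) hopen.uniqueDiffOn ⟨hxs, hxt⟩ le_rfl
  simpa only [iteratedFDerivWithin_of_isOpen _ hopen (⟨hxs, hxt⟩ : x ∈ s ∩ t)] using hbound

end Pointwise

section CmBounds

open scoped NNReal

variable {ι V V' W W' : Type*} [NormedAddCommGroup V] [NormedSpace ℝ V]
  [NormedAddCommGroup V'] [NormedSpace ℝ V'] [NormedAddCommGroup W] [NormedSpace ℝ W]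
  [NormedAddCommGroup W'] [NormedSpace ℝ W'] {m : ℕ} {c d : ι → ℝ} {x : V}

/-- `u i = O(c i)` in `C^m` near `x`, uniformly in `i`. -/
def CmBoundedAt (m : ℕ) (c : ι → ℝ) (u : ι → V → W) (x : V) : Prop :=
  ∃ C : ℝ≥0, ∀ᶠ y in 𝓝 x, ∀ i,
    ContDiffAt ℝ m (u i) y ∧ ∀ j ≤ m, ‖iteratedFDeriv ℝ j (u i) y‖ ≤ C * c i

theorem cmBoundedAt_const {a : V → W} (ha : ContDiffAt ℝ m a x) :
    CmBoundedAt m (fun _ : ι => 1) (fun _ => a) x := by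
  have hcont : ∀ j ∈ Finset.range (m + 1), ∀ᶠ y in 𝓝 x,
      ‖iteratedFDeriv ℝ j a y‖₊ ≤ ‖iteratedFDeriv ℝ j a x‖₊ + 1 := fun j hj =>
    (ha.continuousAt_iteratedFDeriv
      (by simpa [Nat.lt_succ_iff] using hj)).nnnorm.eventually_le_const (lt_add_one _)
  refine ⟨∑ j ∈ Finset.range (m + 1), (‖iteratedFDeriv ℝ j a x‖₊ + 1), ?_⟩
  filter_upwards [(Filter.eventually_all_finset _).2 hcont, ha.eventually (by simp)]
    with y hy hay _
  refine ⟨hay, fun j hj => ?_⟩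
  have hj' : j ∈ Finset.range (m + 1) := by simpa [Nat.lt_succ_iff] using hj
  rw [mul_one]
  exact_mod_cast (hy j hj').trans
    (Finset.single_le_sum (f := fun j => ‖iteratedFDeriv ℝ j a x‖₊ + 1) (by simp) hj')

variable {u v : ι → V → W}

theorem CmBoundedAt.contDiffAt (hu : CmBoundedAt m c u x) (i : ι) : ContDiffAt ℝ m (u i) x :=
  let ⟨_, hC⟩ := hu
  (hC.self_of_nhds i).1

theorem CmBoundedAt.congr (hu : CmBoundedAt m c u x) (huv : ∀ᶠ y in 𝓝 x, ∀ i, u i y = v i y) :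
    CmBoundedAt m c v x := by
  obtain ⟨C, hC⟩ := hu
  refine ⟨C, ?_⟩
  filter_upwards [hC, huv.eventually_nhds] with y hy hyuv i
  have hi : u i =ᶠ[𝓝 y] v i := hyuv.mono fun z hz => hz i
  refine ⟨(hy i).1.congr_of_eventuallyEq hi.symm, fun j hj => ?_⟩
  rw [← (hi.iteratedFDeriv ℝ j).eq_of_nhds]
  exact (hy i).2 j hj

theorem CmBoundedAt.mono (hu : CmBoundedAt m c u x) (hcd : ∀ i, c i ≤ d i) :
    CmBoundedAt m d u x := by
  obtain ⟨C, hC⟩ := hu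
  exact ⟨C, hC.mono fun y hy i => ⟨(hy i).1, fun j hj =>
    ((hy i).2 j hj).trans (mul_le_mul_of_nonneg_left (hcd i) C.coe_nonneg)⟩⟩

theorem CmBoundedAt.sum {κ : Type*} {u : κ → ι → V → W} {s : Finset κ}
    (hu : ∀ k ∈ s, CmBoundedAt m c (u k) x) :
    CmBoundedAt m c (fun i y => ∑ k ∈ s, u k i y) x := by
  choose! C hC using hu
  refine ⟨∑ k ∈ s, C k, ?_⟩
  filter_upwards [(Filter.eventually_all_finset s).2 hC] with y hy i
  refine ⟨ContDiffAt.sum fun k hk => (hy k hk i).1, fun j hj => ?_⟩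
  rw [iteratedFDeriv_fun_sum_apply fun k hk => (hy k hk i).1.of_le (by exact_mod_cast hj),
    NNReal.coe_sum, Finset.sum_mul]
  exact norm_sum_le_of_le _ fun k hk => (hy k hk i).2 j hj

theorem CmBoundedAt.add (hu : CmBoundedAt m c u x) (hv : CmBoundedAt m c v x) :
    CmBoundedAt m c (fun i y => u i y + v i y) x := by
  have hsum := CmBoundedAt.sum (u := ![u, v]) (s := Finset.univ) (c := c) (m := m) (x := x)
    (by simp [Fin.forall_fin_two, hu, hv])
  simpa using hsum

theorem CmBoundedAt.comp {ψ : V → V'} {u : ι → V' → W} (hψ : ContDiffAt ℝ m ψ x)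
    (hu : CmBoundedAt m c u (ψ x)) : CmBoundedAt m c (fun i y => u i (ψ y)) x := by
  obtain ⟨C, hC⟩ := hu
  obtain ⟨D, hD⟩ := cmBoundedAt_const (ι := ι) hψ
  refine ⟨m.factorial * C * max D 1 ^ m, ?_⟩
  filter_upwards [hD, hψ.continuousAt.eventually hC] with y hDy hCy i
  have hψy : ContDiffAt ℝ m ψ y := (hDy i).1
  refine ⟨(hCy i).1.comp y hψy, fun j hj => ?_⟩
  have hjm : (j : WithTop ℕ∞) ≤ m := by exact_mod_cast hj
  have hnonneg : 0 ≤ C * c i := (norm_nonneg _).trans ((hCy i).2 j hj)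
  have hD₁ : (1 : ℝ) ≤ max D 1 := le_max_right _ _
  calc ‖iteratedFDeriv ℝ j (fun y => u i (ψ y)) y‖
      ≤ j.factorial * (C * c i) * (max D 1 : ℝ) ^ j := by
        refine norm_iteratedFDeriv_comp_le_of_contDiffAt ((hCy i).1.of_le hjm) (hψy.of_le hjm)
          (fun k hk => (hCy i).2 k (hk.trans hj)) fun k hk₁ hk => ?_
        refine ((hDy i).2 k (hk.trans hj)).trans ?_
        rw [mul_one]
        exact (le_max_left _ _).trans (le_self_pow₀ hD₁ (Nat.one_le_iff_ne_zero.1 hk₁))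
    _ ≤ m.factorial * (C * c i) * (max D 1 : ℝ) ^ m := by
        gcongr
    _ = (m.factorial * C * max D 1 ^ m : ℝ≥0) * c i := by push_cast; ring

theorem CmBoundedAt.clm_apply {a : ι → V → W →L[ℝ] W'} (ha : CmBoundedAt m c a x)
    (hu : CmBoundedAt m d u x) :
    CmBoundedAt m (fun i => c i * d i) (fun i y => a i y (u i y)) x := by
  obtain ⟨A, hA⟩ := ha
  obtain ⟨C, hC⟩ := hu
  refine ⟨2 ^ m * A * C, ?_⟩
  filter_upwards [hA, hC] with y hAy hCy i
  refine ⟨(hAy i).1.clm_apply (hCy i).1, fun j hj => ?_⟩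
  have hjm : (j : WithTop ℕ∞) ≤ m := by exact_mod_cast hj
  have hA₀ : 0 ≤ A * c i := (norm_nonneg _).trans ((hAy i).2 j hj)
  have hC₀ : 0 ≤ C * d i := (norm_nonneg _).trans ((hCy i).2 j hj)
  calc ‖iteratedFDeriv ℝ j (fun y => a i y (u i y)) y‖
      ≤ ∑ k ∈ Finset.range (j + 1), (j.choose k : ℝ) * ‖iteratedFDeriv ℝ k (a i) y‖ *
          ‖iteratedFDeriv ℝ (j - k) (u i) y‖ :=
        norm_iteratedFDeriv_clm_apply_of_contDiffAt ((hAy i).1.of_le hjm) ((hCy i).1.of_le hjm)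
    _ ≤ ∑ k ∈ Finset.range (j + 1), (j.choose k : ℝ) * (A * c i) * (C * d i) := by
        gcongr with k hk
        · exact (hAy i).2 k ((Finset.mem_range_succ_iff.1 hk).trans hj)
        · exact (hCy i).2 (j - k) ((Nat.sub_le j k).trans hj)
    _ = 2 ^ j * (A * c i) * (C * d i) := by
        rw [← Finset.sum_mul, ← Finset.sum_mul]
        exact_mod_cast congrArg (fun N : ℕ => (N : ℝ) * (A * c i) * (C * d i))
          (Nat.sum_range_choose j)
    _ ≤ 2 ^ m * (A * c i) * (C * d i) := by
        gcongr
        exact one_le_two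
    _ = (2 ^ m * A * C : ℝ≥0) * (c i * d i) := by push_cast; ring

theorem exists_cmBound_of_isCompact {K : Set V} (hK : IsCompact K) (hc : ∀ i, 0 ≤ c i)
    (hu : ∀ x ∈ K, CmBoundedAt m c u x) :
    ∃ C : ℝ≥0, ∀ x ∈ K, ∀ i, ∀ j ≤ m, ‖iteratedFDeriv ℝ j (u i) x‖ ≤ C * c i := by
  refine hK.induction_on (p := fun s => ∃ C : ℝ≥0, ∀ x ∈ s, ∀ i, ∀ j ≤ m,
    ‖iteratedFDeriv ℝ j (u i) x‖ ≤ C * c i) ⟨0, by simp⟩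
    (fun s t hst ⟨C, hC⟩ => ⟨C, fun x hx => hC x (hst hx)⟩) ?_ fun x hx => ?_
  · rintro s t ⟨C, hC⟩ ⟨D, hD⟩
    refine ⟨max C D, fun x hx i j hj => ?_⟩
    rcases hx with hx | hx
    · exact (hC x hx i j hj).trans
        (mul_le_mul_of_nonneg_right (by exact_mod_cast le_max_left C D) (hc i))
    · exact (hD x hx i j hj).trans
        (mul_le_mul_of_nonneg_right (by exact_mod_cast le_max_right C D) (hc i))
  · obtain ⟨C, hC⟩ := hu x hx
    exact ⟨_, mem_nhdsWithin_of_mem_nhds hC, C, fun y hy i => (hy i).2⟩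

end CmBounds

section LocalApproximation

open MeasureTheory Metric
open scoped NNReal

variable {ι V W : Type*} [NormedAddCommGroup V] [NormedSpace ℝ V]
  [NormedAddCommGroup W] [NormedSpace ℝ W] {G : V → W} {U : Set V} {δ : ι → ℝ}

/-- The class `C^{1,1}` on the set `U`. -/
def C11On (G : V → W) (U : Set V) : Prop :=
  ContDiffOn ℝ 1 G U ∧ LocallyLipschitzOn U (fderiv ℝ G)

/-- Near `x` the functions `F i` are `O(δ i)`-close to `G` in `C^1` and bounded in `C^2`, with
constants that do not depend on `i`. -/
def C1ApproxAt (δ : ι → ℝ) (F : ι → V → W) (G : V → W) (x : V) : Prop :=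
  CmBoundedAt 1 δ (fun i y => F i y - G y) x ∧ CmBoundedAt 2 (fun _ => 1) F x

theorem c1ApproxAt_of_eventually {F : ι → V → W} {x : V} {L : ℝ≥0} (hδ : ∀ i, δ i ≤ 1)
    (hF : ∀ i, ContDiff ℝ ∞ (F i)) (hG : ContDiffAt ℝ 1 G x)
    (h : ∀ᶠ y in 𝓝 x, ∀ i, ‖F i y - G y‖ ≤ δ i ∧
      ‖fderiv ℝ (F i) y - fderiv ℝ G y‖ ≤ L * δ i ∧ ‖fderiv ℝ (fderiv ℝ (F i)) y‖ ≤ L) :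
    C1ApproxAt δ F G x := by
  have hdiff : CmBoundedAt 1 δ (fun i y => F i y - G y) x := by
    refine ⟨max 1 L, ?_⟩
    filter_upwards [h, hG.eventually (by simp)] with y hy hGy i
    obtain ⟨h₀, h₁, -⟩ := hy i
    have hFy : ContDiffAt ℝ 1 (F i) y := (hF i).contDiffAt.of_le (by simp)
    have hδi : 0 ≤ δ i := (norm_nonneg _).trans h₀
    refine ⟨hFy.sub hGy, fun j hj => ?_⟩
    interval_cases j
    · rw [norm_iteratedFDeriv_zero]
      exact h₀.trans (le_mul_of_one_le_left hδi (by exact_mod_cast le_max_left 1 L))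
    · rw [norm_iteratedFDeriv_one, fderiv_fun_sub (hFy.differentiableAt one_ne_zero)
        (hGy.differentiableAt one_ne_zero)]
      exact h₁.trans (mul_le_mul_of_nonneg_right (by exact_mod_cast le_max_right 1 L) hδi)
  have hsum : CmBoundedAt 1 (fun _ => 1) F x :=
    ((hdiff.mono hδ).add (cmBoundedAt_const hG)).congr
      (Eventually.of_forall fun y i => sub_add_cancel _ _)
  obtain ⟨C, hC⟩ := hsum
  refine ⟨hdiff, max C L, ?_⟩
  filter_upwards [h, hC] with y hy hCy i
  refine ⟨(hF i).contDiffAt.of_le (by norm_cast), fun j hj => ?_⟩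
  rw [mul_one]
  rcases hj.lt_or_eq with hj | rfl
  · simpa only [mul_one] using ((hCy i).2 j (Nat.lt_succ_iff.1 hj)).trans
      (mul_le_mul_of_nonneg_right (by exact_mod_cast le_max_left C L) zero_le_one)
  · rw [← norm_iteratedFDeriv_fderiv, norm_iteratedFDeriv_one]
    exact (hy i).2.2.trans (by exact_mod_cast le_max_right C L)

theorem contDiff_smul_of_tsupport_subset {k : ℕ∞} {χ : V → ℝ} (hU : IsOpen U)
    (hχ : ContDiff ℝ k χ) (hχU : tsupport χ ⊆ U) (hG : ContDiffOn ℝ k G U) :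
    ContDiff ℝ k fun y => χ y • G y :=
  (contMDiff_of_tsupport fun _ hx => (hχ.contDiffAt.smul (hG.contDiffAt
    (hU.mem_nhds (hχU (tsupport_smul_subset_left χ G hx))))).contMDiffAt).contDiff

variable [FiniteDimensional ℝ V] [CompleteSpace W]

theorem exists_mollified_family (hG : Continuous G) (hsupp : HasCompactSupport G)
    (hδ : ∀ i, 0 < δ i) {r : ℝ} (hr : 0 < r) :
    ∃ F : ι → V → W, (∀ i, ContDiff ℝ ∞ (F i)) ∧ (∀ i x, ‖F i x - G x‖ ≤ δ i) ∧
      (∀ A : W →L[ℝ] W, (∀ x, A (G x) = G x) → ∀ i x, A (F i x) = F i x) ∧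
      ∀ (x₀ : V) (L : ℝ≥0), ContDiff ℝ 1 G →
        LipschitzOnWith L (fderiv ℝ G) (ball x₀ (2 * r)) → ∀ i, ∀ x ∈ ball x₀ r,
          ‖fderiv ℝ (F i) x - fderiv ℝ G x‖ ≤ L * δ i ∧ ‖fderiv ℝ (fderiv ℝ (F i)) x‖ ≤ L := by
  borelize V
  let μ : Measure V := Measure.addHaar
  choose ρ hρ happrox using fun i =>
    exists_norm_mollify_sub_le μ hG hsupp (hδ i) (lt_min (hδ i) hr)
  refine ⟨fun i => mollify μ (ρ i) G, fun i => contDiff_mollify hG, happrox, fun A hA i x => ?_,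
    fun x₀ L hG₁ hL i x hx => ?_⟩
  · simp only [clm_mollify A hG, hA]
  · have hsub : thickening (ρ i).rOut (ball x₀ r) ⊆ ball x₀ (2 * r) := by
      rw [thickening_ball (ρ i).rOut_pos hr]
      exact ball_subset_ball (by linarith [(hρ i).trans (min_le_right (δ i) r)])
    have hcont : Continuous (fderiv ℝ G) := hG₁.continuous_fderiv one_ne_zero
    rw [fderiv_mollify hG₁ hsupp]
    refine ⟨(norm_mollify_sub_le_of_lipschitzOnWith hcont (hL.mono hsub) hx).trans ?_, ?_⟩
    · exact mul_le_mul_of_nonneg_left ((hρ i).trans (min_le_left _ _)) L.coe_nonneg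
    · exact norm_fderiv_le_of_lipschitzOn ℝ (isOpen_ball.mem_nhds hx)
        (lipschitzOnWith_mollify hcont (hL.mono hsub))

theorem exists_local_approx (hU : IsOpen U) (hG : ContinuousOn G U) {x₀ : V} (hx₀ : x₀ ∈ U)
    {A : W →L[ℝ] W} (hA : ∀ x ∈ U, A (G x) = G x) (hδ : ∀ i, 0 < δ i) (hδ₁ : ∀ i, δ i ≤ 1) :
    ∃ s ∈ 𝓝 x₀, ∃ F : ι → V → W, (∀ i, ContDiff ℝ ∞ (F i)) ∧ (∀ i x, A (F i x) = F i x) ∧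
      (∀ i, ∀ x ∈ s, ‖F i x - G x‖ ≤ δ i) ∧ (C11On G U → ∀ x ∈ s, C1ApproxAt δ F G x) := by
  obtain ⟨R, hR, hRU⟩ := nhds_basis_closedBall.mem_iff.1 (hU.mem_nhds hx₀)
  obtain ⟨r, rfl⟩ : ∃ r, R = 3 * r := ⟨R / 3, by ring⟩
  have hr : 0 < r := by linarith
  let χ : ContDiffBump x₀ := ⟨2 * r, 3 * r, by positivity, by linarith⟩
  have hχU : tsupport χ ⊆ U := χ.tsupport_eq.subset.trans hRU
  set G' : V → W := fun y => χ y • G y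
  have hG' : Continuous G' := (contDiff_smul_of_tsupport_subset (k := 0) hU
    χ.contDiff hχU (contDiffOn_zero.2 hG)).continuous
  have hA' : ∀ x, A (G' x) = G' x := fun x => by
    by_cases hx : x ∈ tsupport χ
    · rw [map_smul, hA x (hχU hx)]
    · simp only [G', image_eq_zero_of_notMem_tsupport hx, zero_smul, map_zero]
  have heq : EqOn G' G (ball x₀ (2 * r)) := fun x hx => by
    simp only [G', χ.one_of_mem_closedBall (ball_subset_closedBall hx), one_smul]
  obtain ⟨F, hF, hFG, hFA, hFd⟩ :=
    exists_mollified_family (ι := ι) hG' χ.hasCompactSupport.smul_right hδ hr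
  have hball : ball x₀ r ⊆ ball x₀ (2 * r) := ball_subset_ball (by linarith)
  have hclose : ∀ i, ∀ x ∈ ball x₀ r, ‖F i x - G x‖ ≤ δ i := fun i x hx =>
    heq (hball hx) ▸ hFG i x
  refine ⟨ball x₀ r, ball_mem_nhds x₀ hr, F, hF, hFA A hA', hclose, fun ⟨hG₁, hlip⟩ x hx => ?_⟩
  have hballU : closedBall x₀ (2 * r) ⊆ U := (closedBall_subset_closedBall (by linarith)).trans hRU
  obtain ⟨L, hL⟩ := (hlip.mono hballU).exists_lipschitzOnWith_of_compact (isCompact_closedBall _ _)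
  have hfderiv : EqOn (fderiv ℝ G') (fderiv ℝ G) (ball x₀ (2 * r)) := fun y hy =>
    (heq.eventuallyEq_of_mem (isOpen_ball.mem_nhds hy)).fderiv_eq
  have hL' : LipschitzOnWith L (fderiv ℝ G') (ball x₀ (2 * r)) :=
    fun y hy z hz => by
      rw [hfderiv hy, hfderiv hz]
      exact hL (ball_subset_closedBall hy) (ball_subset_closedBall hz)
  refine c1ApproxAt_of_eventually (L := L) hδ₁ hF (hG₁.contDiffAt (hU.mem_nhds
    (hballU (ball_subset_closedBall (hball hx))))) ?_
  filter_upwards [isOpen_ball.mem_nhds hx] with y hy i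
  have hFdy := hFd x₀ L (contDiff_smul_of_tsupport_subset (k := 1) hU
    χ.contDiff hχU hG₁) hL' i y hy
  rw [hfderiv (hball hy)] at hFdy
  exact ⟨hclose i y hy, hFdy⟩

end LocalApproximation

section LorentzForms

variable {V V' : Type*} [TopologicalSpace V] [AddCommGroup V] [Module ℝ V]
  [TopologicalSpace V'] [AddCommGroup V'] [Module ℝ V']

/-- Symmetric bilinear forms of signature `(-,+,…,+)`, in the formulation of
`TensorField.IsLorentzian`. -/
def IsLorentzForm (b : V →L[ℝ] V →L[ℝ] ℝ) : Prop :=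
  (∀ X Y, b X Y = b Y X) ∧ ∃ v, b v v < 0 ∧ ∀ w, w ≠ 0 → b v w = 0 → 0 < b w w

/-- The forms `b` and `g` differ by at most `r` in the norm defined by `h`. -/
def IsCloseWrt (h : V →L[ℝ] V →L[ℝ] ℝ) (r : ℝ) (b g : V →L[ℝ] V →L[ℝ] ℝ) : Prop :=
  ∀ X Y, |b X Y - g X Y| ≤ r * (√(h X X) * √(h Y Y))

/-- All symmetric forms in the closed `r`-ball around `g` are Lorentzian. -/
def IsLorentzRadius (h g : V →L[ℝ] V →L[ℝ] ℝ) (r : ℝ) : Prop :=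
  ∀ b : V →L[ℝ] V →L[ℝ] ℝ, (∀ X Y, b X Y = b Y X) → IsCloseWrt h r b g → IsLorentzForm b

/-- `b` is a symmetric form that is `ε`-close to `g` and has smaller (`σ = 1`) or larger (`σ = -1`)
light cone. That `b` is Lorentzian is not a convex condition on `b`; it is replaced by the
condition that `b` lies in a ball around `g` that consists of Lorentzian forms. -/
structure ConeApprox (σ ε : ℝ) (g h b : V →L[ℝ] V →L[ℝ] ℝ) : Prop where
  symm : ∀ X Y, b X Y = b Y X
  cone : ∀ X, X ≠ 0 → 0 ≤ σ * g X X → 0 < σ * b X X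
  exists_radius : ∃ r ≤ ε, IsLorentzRadius h g r ∧ IsCloseWrt h r b g

variable {g h b : V →L[ℝ] V →L[ℝ] ℝ} {g' h' b' : V' →L[ℝ] V' →L[ℝ] ℝ} {r s σ ε ε' : ℝ}

theorem IsCloseWrt.mono (hb : IsCloseWrt h r b g) (hrs : r ≤ s) : IsCloseWrt h s b g :=
  fun X Y => (hb X Y).trans (mul_le_mul_of_nonneg_right hrs (by positivity))

theorem IsLorentzRadius.anti (hg : IsLorentzRadius h g s) (hrs : r ≤ s) : IsLorentzRadius h g r :=
  fun b hb hbg => hg b hb (hbg.mono hrs)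

theorem ConeApprox.mono (hb : ConeApprox σ ε g h b) (hε : ε ≤ ε') : ConeApprox σ ε' g h b :=
  let ⟨r, hr, hb'⟩ := hb.exists_radius
  ⟨hb.symm, hb.cone, r, hr.trans hε, hb'⟩

theorem ConeApprox.isLorentzForm (hb : ConeApprox σ ε g h b) : IsLorentzForm b :=
  let ⟨_, _, hr, hbg⟩ := hb.exists_radius
  hr b hb.symm hbg

theorem ConeApprox.isCloseWrt (hb : ConeApprox σ ε g h b) : IsCloseWrt h ε b g :=
  let ⟨_, hr, _, hbg⟩ := hb.exists_radius
  hbg.mono hr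

theorem convex_isCloseWrt : Convex ℝ {b | IsCloseWrt h r b g} :=
  fun b₁ hb₁ b₂ hb₂ s t hs ht hst X Y => by
    have hball := convex_closedBall (g X Y) (r * (√(h X X) * √(h Y Y)))
      (Metric.mem_closedBall.2 (hb₁ X Y)) (Metric.mem_closedBall.2 (hb₂ X Y)) hs ht hst
    simpa [Real.dist_eq] using hball

theorem convex_coneApprox : Convex ℝ {b | ConeApprox σ ε g h b} := by
  intro b₁ hb₁ b₂ hb₂ s t hs ht hst
  obtain ⟨r₁, hr₁, hL₁, hc₁⟩ := hb₁.exists_radius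
  obtain ⟨r₂, hr₂, hL₂, hc₂⟩ := hb₂.exists_radius
  refine ⟨fun X Y => ?_, fun X hX hg => ?_, max r₁ r₂, max_le hr₁ hr₂, ?_, ?_⟩
  · simp only [add_apply, smul_apply, hb₁.symm X Y, hb₂.symm X Y]
  · have hpos := convex_Ioi (0 : ℝ) (hb₁.cone X hX hg) (hb₂.cone X hX hg) hs ht hst
    simpa [mul_add, mul_left_comm] using hpos
  · rcases max_choice r₁ r₂ with h | h <;> rwa [h]
  · exact convex_isCloseWrt (hc₁.mono (le_max_left _ _)) (hc₂.mono (le_max_right _ _)) hs ht hst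

/-- The pullback of a bilinear form along a linear map. -/
def pull (b : V' →L[ℝ] V' →L[ℝ] ℝ) (A : V →L[ℝ] V') : V →L[ℝ] V →L[ℝ] ℝ :=
  (ContinuousLinearMap.precomp ℝ A).comp (b.comp A)

@[simp]
theorem pull_apply (A : V →L[ℝ] V') (X Y : V) : pull b' A X Y = b' (A X) (A Y) := rfl

theorem pull_sum_smul {ι : Type*} (s : Finset ι) (c : ι → ℝ) (b : ι → V' →L[ℝ] V' →L[ℝ] ℝ)
    (A : V →L[ℝ] V') : pull (∑ i ∈ s, c i • b i) A = ∑ i ∈ s, c i • pull (b i) A := by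
  ext X Y
  simp

theorem IsLorentzForm.pull (hb : IsLorentzForm b') (A : V ≃L[ℝ] V') :
    IsLorentzForm (pull b' (A : V →L[ℝ] V')) := by
  obtain ⟨hsymm, v, hv, hpos⟩ := hb
  refine ⟨fun X Y => hsymm _ _, A.symm v, by simpa using hv, fun w hw hvw => ?_⟩
  exact hpos (A w) (A.map_ne_zero_iff.2 hw) (by simpa using hvw)

theorem ConeApprox.pull (hb : ConeApprox σ ε g' h' b') (A : V ≃L[ℝ] V') :
    ConeApprox σ ε (pull g' (A : V →L[ℝ] V')) (pull h' (A : V →L[ℝ] V'))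
      (pull b' (A : V →L[ℝ] V')) := by
  obtain ⟨r, hr, hL, hc⟩ := hb.exists_radius
  refine ⟨fun X Y => hb.symm _ _, fun X hX => hb.cone (A X) (A.map_ne_zero_iff.2 hX), r, hr,
    fun b hb hbg => ?_, fun X Y => hc _ _⟩
  have hpull : IsLorentzForm (LorentzApprox.pull b (A.symm : V' →L[ℝ] V)) :=
    hL _ (fun X Y => hb _ _) fun X Y => by simpa using hbg (A.symm X) (A.symm Y)
  simpa [IsLorentzForm] using hpull.pull A

theorem isLorentzForm_of_pos_of_apply_eq_zero (hb : ∀ X Y, b X Y = b Y X) {T : V}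
    (hT : b T T < 0) {θ : V →L[ℝ] ℝ} (hθ : ∀ w ≠ 0, θ w = 0 → 0 < b w w) : IsLorentzForm b := by
  refine ⟨hb, T, hT, fun w hw hTw => ?_⟩
  have hθT : θ T ≠ 0 := fun h => (hθ T (by rintro rfl; simp at hT) h).not_gt hT
  obtain ⟨α, hα⟩ : ∃ α, α * θ T = θ w := ⟨θ w / θ T, div_mul_cancel₀ _ hθT⟩
  have hwT : b w T = 0 := hb w T ▸ hTw
  have hu : w - α • T ≠ 0 := fun hu => by
    rw [sub_eq_zero.1 hu, map_smul, smul_eq_mul, mul_eq_zero, or_iff_left hT.ne] at hTw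
    exact hw (by rw [sub_eq_zero.1 hu, hTw, zero_smul])
  have hpos : 0 < b (w - α • T) (w - α • T) := hθ _ hu (by simp [hα])
  have hexpand : b (w - α • T) (w - α • T) = b w w + α ^ 2 * b T T := by
    simp only [map_sub, map_smul, sub_apply, smul_apply, smul_eq_mul, hTw, hwT]
    ring
  nlinarith [sq_nonneg α]

theorem isLorentzRadius_of_lt (hh : ∀ w, 0 ≤ h w w) {T : V} (hT : g T T + r * h T T < 0)
    {θ : V →L[ℝ] ℝ} (hθ : ∀ w ≠ 0, θ w = 0 → r * h w w < g w w) : IsLorentzRadius h g r := by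
  intro b hb hbg
  have hdiff : ∀ w, |b w w - g w w| ≤ r * h w w := fun w =>
    (hbg w w).trans_eq (by rw [Real.mul_self_sqrt (hh w)])
  refine isLorentzForm_of_pos_of_apply_eq_zero hb (T := T) ?_ (θ := θ) fun w hw hw₀ => ?_
  · linarith [(abs_le.1 (hdiff T)).2]
  · linarith [(abs_le.1 (hdiff w)).1, hθ w hw hw₀]

theorem IsLorentzForm.exists_pos_add_mul_sq (hg : IsLorentzForm g) :
    ∃ T, ∃ K > 0, g T T < 0 ∧ ∀ w ≠ 0, 0 < g w w + K * g T w ^ 2 := by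
  obtain ⟨hsymm, T, hT, hpos⟩ := hg
  have hT' : 0 < -g T T := neg_pos.2 hT
  refine ⟨T, 2 / -g T T, by positivity, hT, fun w hw => ?_⟩
  obtain ⟨α, hα⟩ : ∃ α, g T w = α * g T T := ⟨g T w / g T T, (div_mul_cancel₀ _ hT.ne).symm⟩
  have hexpand : g w w + 2 / -g T T * g T w ^ 2 =
      g (w - α • T) (w - α • T) + α ^ 2 * -g T T := by
    simp only [map_sub, map_smul, sub_apply, smul_apply, smul_eq_mul, hsymm w T, hα]
    field_simp
    ring
  rw [hexpand]
  by_cases hu : w - α • T = 0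
  · have hα₀ : α ≠ 0 := fun h => hw (by simpa [h] using hu)
    rw [hu, map_zero, zero_add]
    positivity
  · have hpos' := hpos _ hu (by simp [hα])
    positivity

end LorentzForms

section Perturbation

variable {V : Type*} [NormedAddCommGroup V] [NormedSpace ℝ V] {g h b : V →L[ℝ] V →L[ℝ] ℝ}

theorem abs_sub_apply_apply_le {C : ℝ} (hbg : ‖b - g‖ ≤ C) (X Y : V) :
    |b X Y - g X Y| ≤ C * (‖X‖ * ‖Y‖) :=
  ((b - g).le_opNorm₂ X Y).trans (by rw [mul_assoc]; gcongr)

theorem isCloseWrt_of_norm_sub_le {m r : ℝ} (hm : 0 ≤ m) (hr : 0 ≤ r)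
    (hh : ∀ w, m * ‖w‖ ^ 2 ≤ h w w) (hbg : ‖b - g‖ ≤ r * m) : IsCloseWrt h r b g := fun X Y => by
  have hsqrt : ∀ w, √m * ‖w‖ ≤ √(h w w) := fun w =>
    Real.le_sqrt_of_sq_le (by rw [mul_pow, Real.sq_sqrt hm]; exact hh w)
  calc |b X Y - g X Y| ≤ r * m * (‖X‖ * ‖Y‖) := abs_sub_apply_apply_le hbg X Y
    _ = r * ((√m * ‖X‖) * (√m * ‖Y‖)) := by
        rw [mul_mul_mul_comm √m, Real.mul_self_sqrt hm, mul_assoc]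
    _ ≤ r * (√(h X X) * √(h Y Y)) := by
        gcongr
        · exact hsqrt X
        · exact hsqrt Y

theorem pos_of_norm_sub_add_smul_smulRight_le {σ K c κ lam : ℝ} {θ : V →L[ℝ] ℝ} (hσ : |σ| = 1)
    (hg : ∀ w, c * ‖w‖ ^ 2 ≤ g w w + K * θ w ^ 2) (hlam : 0 < lam) (hK : lam ≤ K)
    (hκ : K * κ < c) (hb : ‖b - (g + (σ * lam) • θ.smulRight θ)‖ ≤ κ * lam) {X : V} (hX : X ≠ 0)
    (hgX : 0 ≤ σ * g X X) : 0 < σ * b X X := by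
  have hσσ : σ * σ = 1 := by rw [← abs_mul_abs_self, hσ, one_mul]
  have hK₀ : 0 < K := hlam.trans_le hK
  have hdiff : |σ * b X X - (σ * g X X + lam * θ X ^ 2)| ≤ κ * lam * ‖X‖ ^ 2 := by
    have hbX := abs_sub_apply_apply_le hb X X
    rw [← one_mul |_|, ← hσ, ← abs_mul] at hbX
    refine le_of_eq_of_le (congrArg abs ?_) (hbX.trans_eq (by rw [sq]))
    simp only [add_apply, smul_apply, ContinuousLinearMap.smulRight_apply, smul_eq_mul]
    linear_combination lam * θ X ^ 2 * hσσ
  have hgσ : lam * g X X ≤ K * (σ * g X X) := by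
    have habs : g X X ≤ σ * g X X := by
      rw [← abs_of_nonneg hgX, abs_mul, hσ, one_mul]
      exact le_abs_self _
    exact (mul_le_mul_of_nonneg_left habs hlam.le).trans (mul_le_mul_of_nonneg_right hK hgX)
  -- Multiply `σ b(X, X) ≈ σ g(X, X) + λ θ(X)²` by `K` and bound `K θ(X)²` from below by `hg`.
  have hgap : 0 < lam * (c - K * κ) * ‖X‖ ^ 2 := by
    have := sub_pos.2 hκ
    positivity
  have hKb : 0 < K * (σ * b X X) := by
    have hlow := mul_le_mul_of_nonneg_left (hg X) hlam.le
    have hdiff' := mul_le_mul_of_nonneg_left (abs_le.1 hdiff).1 hK₀.le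
    linarith
  exact pos_of_mul_pos_right hKb hK₀.le

variable [FiniteDimensional ℝ V] {g₀ h₀ : V →L[ℝ] V →L[ℝ] ℝ}

theorem exists_pos_mul_norm_sq_le (hb : ∀ w ≠ 0, 0 < b w w) :
    ∃ c > 0, ∀ w, c * ‖w‖ ^ 2 ≤ b w w := by
  rcases subsingleton_or_nontrivial V with _ | _
  · exact ⟨1, one_pos, fun w => by simp [Subsingleton.elim w 0]⟩
  have hcont : Continuous fun w => b w w := by fun_prop
  obtain ⟨v, hv, hmin⟩ := (isCompact_sphere (0 : V) 1).exists_isMinOn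
    (NormedSpace.sphere_nonempty.2 zero_le_one) hcont.continuousOn
  refine ⟨b v v, hb v (ne_zero_of_mem_unit_sphere ⟨v, hv⟩), fun w => ?_⟩
  rcases eq_or_ne w 0 with rfl | hw
  · simp
  have hle : b v v ≤ b (‖w‖⁻¹ • w) (‖w‖⁻¹ • w) := hmin (by simp [norm_smul, hw])
  calc b v v * ‖w‖ ^ 2 ≤ b (‖w‖⁻¹ • w) (‖w‖⁻¹ • w) * ‖w‖ ^ 2 := by gcongr
    _ = b w w := by
      simp only [map_smul, smul_apply, smul_eq_mul]
      field_simp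

theorem exists_eventually_mul_norm_sq_le (hb : ∀ w ≠ 0, 0 < g₀ w w) :
    ∃ c > 0, ∀ᶠ b in 𝓝 g₀, ∀ w, c * ‖w‖ ^ 2 ≤ b w w := by
  obtain ⟨c, hc, hlow⟩ := exists_pos_mul_norm_sq_le hb
  refine ⟨c / 2, half_pos hc, ?_⟩
  filter_upwards [eventually_norm_sub_lt g₀ (half_pos hc)] with b hb w
  have hdiff : |b w w - g₀ w w| ≤ c / 2 * (‖w‖ * ‖w‖) := abs_sub_apply_apply_le hb.le w w
  linarith [hlow w, (abs_le.1 hdiff).1]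

theorem exists_eventually_isLorentzRadius {T : V} {θ : V →L[ℝ] ℝ} {K : ℝ} (hT : g₀ T T < 0)
    (hg₀ : ∀ w ≠ 0, 0 < g₀ w w + K * θ w ^ 2) (hh₀ : ∀ w ≠ 0, 0 < h₀ w w) :
    ∃ R > 0, ∀ᶠ gh in 𝓝 (g₀, h₀), IsLorentzRadius gh.2 gh.1 R := by
  obtain ⟨c, hc, hg⟩ := exists_eventually_mul_norm_sq_le (g₀ := g₀ + K • θ.smulRight θ)
    fun w hw => by simpa [sq] using hg₀ w hw
  obtain ⟨m, hm, hh⟩ := exists_eventually_mul_norm_sq_le hh₀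
  have hsmall : ∀ᶠ R in 𝓝[>] (0 : ℝ), R * (‖h₀‖ + 1) < c ∧ g₀ T T + R * h₀ T T < 0 := by
    refine nhdsWithin_le_nhds (Eventually.and ?_ ?_)
    · exact ContinuousAt.eventually_lt (by fun_prop) continuousAt_const (by simpa using hc)
    · exact ContinuousAt.eventually_lt (by fun_prop) continuousAt_const (by simpa using hT)
  obtain ⟨R, ⟨hRc, hRT⟩, hR⟩ := (hsmall.and self_mem_nhdsWithin).exists
  refine ⟨R, hR, ?_⟩
  have hg' : ∀ᶠ g in 𝓝 g₀, ∀ w, c * ‖w‖ ^ 2 ≤ (g + K • θ.smulRight θ) w w :=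
    (continuous_add_const _).continuousAt.eventually hg
  have hT' : ∀ᶠ gh in 𝓝 (g₀, h₀), gh.1 T T + R * gh.2 T T < 0 :=
    ContinuousAt.eventually_lt (by fun_prop) continuousAt_const hRT
  have hnorm : ∀ᶠ h in 𝓝 h₀, ‖h‖ < ‖h₀‖ + 1 :=
    continuous_norm.continuousAt.eventually_lt_const (lt_add_one _)
  filter_upwards [hg'.prod_inl_nhds h₀, hh.prod_inr_nhds g₀, hnorm.prod_inr_nhds g₀, hT']
    with gh hgh hhgh hnormgh hTgh
  refine isLorentzRadius_of_lt (fun w => (by positivity : 0 ≤ m * ‖w‖ ^ 2).trans (hhgh w)) hTgh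
    (θ := θ) fun w hw hθw => ?_
  have : 0 < ‖w‖ := norm_pos_iff.2 hw
  calc R * gh.2 w w ≤ R * ((‖h₀‖ + 1) * (‖w‖ * ‖w‖)) := by
        gcongr
        rw [← mul_assoc]
        exact (Real.le_norm_self _).trans ((gh.2.le_opNorm₂ w w).trans (by gcongr))
    _ = R * (‖h₀‖ + 1) * ‖w‖ ^ 2 := by ring
    _ < c * ‖w‖ ^ 2 := by gcongr
    _ ≤ gh.1 w w := by simpa [hθw] using hgh w

theorem norm_sub_le_of_norm_sub_add_smul_le {W : Type*} [SeminormedAddCommGroup W]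
    [NormedSpace ℝ W] {a b q : W} {κ t : ℝ} (ht : 0 ≤ t) (h : ‖b - (a + t • q)‖ ≤ κ * t) :
    ‖b - a‖ ≤ (κ + ‖q‖) * t := calc
  ‖b - a‖ = ‖(b - (a + t • q)) + t • q‖ := by congr 1; abel
  _ ≤ κ * t + ‖q‖ * t :=
    (norm_add_le _ _).trans (add_le_add h (by rw [norm_smul, Real.norm_of_nonneg ht, mul_comm]))
  _ = (κ + ‖q‖) * t := by ring

theorem exists_coneApprox_nhds {σ : ℝ} (hσ : |σ| = 1) (hg₀ : IsLorentzForm g₀)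
    (hh₀ : ∀ w ≠ 0, 0 < h₀ w w) :
    ∃ q : V →L[ℝ] V →L[ℝ] ℝ, ∃ κ > 0, (∀ X Y, q X Y = q Y X) ∧
      ∀ᶠ gh in 𝓝 (g₀, h₀), ∀ (ε : ℝ) (b : V →L[ℝ] V →L[ℝ] ℝ), 0 < ε → ε ≤ 1 →
        (∀ X Y, b X Y = b Y X) → ‖b - (gh.1 + ε • q)‖ ≤ κ * ε → ConeApprox σ ε gh.1 gh.2 b := by
  obtain ⟨T, K, hK, hT, hpos⟩ := hg₀.exists_pos_add_mul_sq
  set θ : V →L[ℝ] ℝ := g₀ T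
  set θθ : V →L[ℝ] V →L[ℝ] ℝ := θ.smulRight θ
  obtain ⟨c, hc, hlow⟩ := exists_eventually_mul_norm_sq_le (g₀ := g₀ + K • θθ)
    fun w hw => by simpa [θθ, sq] using hpos w hw
  obtain ⟨m, hm, hh⟩ := exists_eventually_mul_norm_sq_le hh₀
  obtain ⟨R, hR, hrad⟩ := exists_eventually_isLorentzRadius hT hpos hh₀
  obtain ⟨ρ, hρ, hρR, hρ₁⟩ : ∃ ρ > 0, ρ ≤ R ∧ ρ ≤ 1 :=
    ⟨min R 1, by positivity, min_le_left _ _, min_le_right _ _⟩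
  -- The error `κ λ` must be too small to undo the cone change by `λ θ²`, and both must be too small
  -- to leave the ball of Lorentzian forms.
  obtain ⟨κ, hκ, hκK⟩ : ∃ κ > 0, K * κ < c := ⟨c / (2 * K), by positivity, by field_simp; norm_num⟩
  obtain ⟨lam, hlam, hlamK, hlamρ⟩ : ∃ lam > 0, lam ≤ K ∧ (κ + ‖θθ‖) * lam ≤ ρ * m :=
    ⟨min K (ρ * m / (κ + ‖θθ‖)), by positivity, min_le_left _ _,
      (mul_le_mul_of_nonneg_left (min_le_right _ _) (by positivity)).trans_eq
        (mul_div_cancel₀ _ (by positivity))⟩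
  have hlow' : ∀ᶠ g in 𝓝 g₀, ∀ w, c * ‖w‖ ^ 2 ≤ (g + K • θθ) w w :=
    (continuous_add_const _).continuousAt.eventually hlow
  refine ⟨(σ * lam) • θθ, κ * lam, by positivity, fun X Y => by simp [θθ, mul_comm], ?_⟩
  filter_upwards [hlow'.prod_inl_nhds h₀, hh.prod_inr_nhds g₀, hrad] with ⟨g, h⟩ hg hh hR
    ε b hε hε₁ hb hbg
  have hq : ‖(σ * lam) • θθ‖ = lam * ‖θθ‖ := by
    rw [norm_smul, Real.norm_eq_abs, abs_mul, hσ, one_mul, abs_of_pos hlam]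
  have hclose : ‖b - g‖ ≤ ε * ρ * m := calc
    ‖b - g‖ ≤ (κ * lam + ‖(σ * lam) • θθ‖) * ε := norm_sub_le_of_norm_sub_add_smul_le hε.le hbg
    _ = ((κ + ‖θθ‖) * lam) * ε := by rw [hq]; ring
    _ ≤ (ρ * m) * ε := by gcongr
    _ = ε * ρ * m := by ring
  refine ⟨hb, fun X hX hgX => ?_, ε * ρ, mul_le_of_le_one_right hε.le hρ₁,
    hR.anti ((mul_le_of_le_one_left hρ.le hε₁).trans hρR),
    isCloseWrt_of_norm_sub_le hm.le (by positivity) hh hclose⟩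
  exact pos_of_norm_sub_add_smul_smulRight_le hσ (fun w => by simpa [θθ, sq] using hg w)
    (by positivity) ((mul_le_of_le_one_left hlam.le hε₁).trans hlamK) hκK
    (by convert hbg using 1
        · rw [smul_smul, mul_left_comm]
        · ring) hX hgX

end Perturbation

section C11Functions

variable {V W W' : Type*} [NormedAddCommGroup V] [NormedSpace ℝ V]
  [NormedAddCommGroup W] [NormedSpace ℝ W] [NormedAddCommGroup W'] [NormedSpace ℝ W']
  {U : Set V} {f g : V → W}

theorem locallyLipschitzOn_congr {X Y : Type*} [PseudoEMetricSpace X] [PseudoEMetricSpace Y]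
    {s : Set X} {a b : X → Y} (h : EqOn a b s) :
    LocallyLipschitzOn s a ↔ LocallyLipschitzOn s b := by
  rw [locallyLipschitzOn_iff_restrict, locallyLipschitzOn_iff_restrict,
    domRestrict_eq_domRestrict_iff.2 h]

theorem C11On.add (hU : IsOpen U) (hf : C11On f U) (hg : C11On g U) :
    C11On (fun x => f x + g x) U := by
  refine ⟨hf.1.add hg.1, (locallyLipschitzOn_congr fun x hx => ?_).2 (hf.2.add hg.2)⟩
  exact fderiv_fun_add ((hf.1.differentiableOn one_ne_zero).differentiableAt (hU.mem_nhds hx))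
    ((hg.1.differentiableOn one_ne_zero).differentiableAt (hU.mem_nhds hx))

theorem C11On.clm_comp (hU : IsOpen U) (L : W →L[ℝ] W') (hf : C11On f U) :
    C11On (fun x => L (f x)) U := by
  refine ⟨L.contDiff.comp_contDiffOn hf.1, (locallyLipschitzOn_congr
    (b := fun x => ContinuousLinearMap.compL ℝ V W W' L (fderiv ℝ f x)) fun x hx => ?_).2
      fun x hx => ?_⟩
  · exact (L.hasFDerivAt.comp x ((hf.1.differentiableOn one_ne_zero).differentiableAt
      (hU.mem_nhds hx)).hasFDerivAt).fderiv
  · obtain ⟨K, t, ht, hK⟩ := hf.2 hx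
    exact ⟨_, t, ht, (ContinuousLinearMap.compL ℝ V W W' L).lipschitz.comp_lipschitzOnWith hK⟩

theorem C11On.sum {ι : Type*} (hU : IsOpen U) {f : ι → V → W} {s : Finset ι}
    (hf : ∀ i ∈ s, C11On (f i) U) : C11On (fun x => ∑ i ∈ s, f i x) U := by
  classical
  induction s using Finset.induction_on with
  | empty =>
    simp only [Finset.sum_empty]
    refine ⟨contDiffOn_const, ?_⟩
    rw [fderiv_fun_const]
    exact (LocallyLipschitz.const 0).locallyLipschitzOn
  | insert a s ha ih =>
    simp only [Finset.sum_insert ha]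
    exact (hf a (s.mem_insert_self a)).add hU (ih fun i hi => hf i (Finset.mem_insert_of_mem hi))

end C11Functions

section Charts

variable {n : ℕ} {M : Type*} [TopologicalSpace M] [ChartedSpace (E n) M]

/-- The tensor field `g` read in the chart `φ`, that is, `(φ⁻¹)^* g` on `φ.target`. -/
def inChart (g : TensorField n M) (φ : OpenPartialHomeomorph M (E n)) (x : E n) :
    E n →L[ℝ] E n →L[ℝ] ℝ :=
  pull (g (φ.symm x)) (mfderiv (𝓡 n) (𝓡 n) φ.symm x : E n →L[ℝ] TangentSpace (𝓡 n) (φ.symm x))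

/-- The tensor field `φ^* F` on `φ.source`, where `F` is a field of bilinear forms on `ℝⁿ`. -/
def ofChart (F : E n → E n →L[ℝ] E n →L[ℝ] ℝ) (φ : OpenPartialHomeomorph M (E n)) :
    TensorField n M := fun p =>
  pull (F (φ p)) (mfderiv (𝓡 n) (𝓡 n) φ p : TangentSpace (𝓡 n) p →L[ℝ] E n)

/-- The `(i, j)` matrix entry of a bilinear form on `ℝⁿ`. -/
def entryCLM (i j : Fin n) : (E n →L[ℝ] E n →L[ℝ] ℝ) →L[ℝ] ℝ :=
  (ContinuousLinearMap.apply ℝ ℝ (EuclideanSpace.single j (1 : ℝ) : E n)).comp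
    (ContinuousLinearMap.apply ℝ (E n →L[ℝ] ℝ) (EuclideanSpace.single i (1 : ℝ) : E n))

theorem entryCLM_inChart (g : TensorField n M) (φ : OpenPartialHomeomorph M (E n)) (i j : Fin n)
    (x : E n) : entryCLM i j (inChart g φ x) = component g φ i j x := rfl

theorem norm_entryCLM_le (i j : Fin n) : ‖entryCLM i j‖ ≤ 1 := by
  refine ContinuousLinearMap.opNorm_le_bound _ zero_le_one fun b => ?_
  simpa [entryCLM] using
    b.le_opNorm₂ (EuclideanSpace.single i (1 : ℝ)) (EuclideanSpace.single j (1 : ℝ))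

theorem eq_sum_entryCLM_smul (b : E n →L[ℝ] E n →L[ℝ] ℝ) :
    b = ∑ i, ∑ j, entryCLM i j b • (EuclideanSpace.proj i : E n →L[ℝ] ℝ).smulRight
      (EuclideanSpace.proj j : E n →L[ℝ] ℝ) := by
  have hsum : ∀ u : E n, u = ∑ i, u i • EuclideanSpace.single i (1 : ℝ) := fun u => by
    simpa using ((EuclideanSpace.basisFun (Fin n) ℝ).sum_repr u).symm
  ext u v
  conv_lhs => rw [hsum u, hsum v]
  simpa [entryCLM, Finset.mul_sum, mul_comm, mul_assoc, mul_left_comm] using Finset.sum_comm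

theorem TensorField.IsC11.c11On_inChart {g : TensorField n M} (hg : g.IsC11)
    {φ : OpenPartialHomeomorph M (E n)} (hφ : φ ∈ IsManifold.maximalAtlas (𝓡 n) ∞ M) :
    C11On (inChart g φ) φ.target := by
  rw [funext fun x => eq_sum_entryCLM_smul (inChart g φ x)]
  exact C11On.sum φ.open_target fun i _ => C11On.sum φ.open_target fun j _ =>
    C11On.clm_comp φ.open_target (ContinuousLinearMap.toSpanSingleton ℝ _) (hg φ hφ i j)

theorem TensorField.apply_congr (g : TensorField n M) {p q : M} (h : p = q) (u v : E n) :
    g p u v = g q u v := by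
  subst h
  rfl

variable {φ φ' : OpenPartialHomeomorph M (E n)}

theorem mdifferentiable_of_mem_maximalAtlas (hφ : φ ∈ IsManifold.maximalAtlas (𝓡 n) ∞ M) :
    φ.MDifferentiable (𝓡 n) (𝓡 n) :=
  ⟨(contMDiffOn_of_mem_maximalAtlas hφ).mdifferentiableOn (by simp),
    (contMDiffOn_symm_of_mem_maximalAtlas hφ).mdifferentiableOn (by simp)⟩

theorem contDiffOn_transition (hφ : φ ∈ IsManifold.maximalAtlas (𝓡 n) ∞ M)
    (hφ' : φ' ∈ IsManifold.maximalAtlas (𝓡 n) ∞ M) :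
    ContDiffOn ℝ ∞ (φ' ∘ φ.symm) (φ.target ∩ φ.symm ⁻¹' φ'.source) :=
  contMDiffOn_iff_contDiffOn.1 ((contMDiffOn_of_mem_maximalAtlas hφ').comp
    ((contMDiffOn_symm_of_mem_maximalAtlas hφ).mono inter_subset_left) fun _ hx => hx.2)

theorem ofChart_inChart (g : TensorField n M) (hφ : φ ∈ IsManifold.maximalAtlas (𝓡 n) ∞ M) {p : M}
    (hp : p ∈ φ.source) : ofChart (inChart g φ) φ p = g p := by
  have hinv : ∀ v : E n,
      (mfderiv (𝓡 n) (𝓡 n) φ.symm (φ p) (mfderiv (𝓡 n) (𝓡 n) φ p v : E n) : E n) = v :=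
    DFunLike.congr_fun ((mdifferentiable_of_mem_maximalAtlas hφ).symm_comp_deriv hp)
  ext u v
  calc ofChart (inChart g φ) φ p u v
      = g (φ.symm (φ p))
          (mfderiv (𝓡 n) (𝓡 n) φ.symm (φ p) (mfderiv (𝓡 n) (𝓡 n) φ p u : E n) : E n)
          (mfderiv (𝓡 n) (𝓡 n) φ.symm (φ p) (mfderiv (𝓡 n) (𝓡 n) φ p v : E n) : E n) := rfl
    _ = g (φ.symm (φ p)) u v :=
        congrArg₂ (fun a b : E n => g (φ.symm (φ p)) a b) (hinv u) (hinv v)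
    _ = g p u v := g.apply_congr (φ.left_inv hp) u v

theorem inChart_ofChart (F : E n → E n →L[ℝ] E n →L[ℝ] ℝ)
    (hφ : φ ∈ IsManifold.maximalAtlas (𝓡 n) ∞ M) (hφ' : φ' ∈ IsManifold.maximalAtlas (𝓡 n) ∞ M)
    {x : E n} (hx : x ∈ φ.target) (hx' : φ.symm x ∈ φ'.source) :
    inChart (ofChart F φ') φ x = pull (F ((φ' ∘ φ.symm) x)) (fderiv ℝ (φ' ∘ φ.symm) x) := by
  have hchain : mfderiv (𝓡 n) (𝓡 n) (φ' ∘ φ.symm) x =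
      (mfderiv (𝓡 n) (𝓡 n) φ' (φ.symm x)).comp (mfderiv (𝓡 n) (𝓡 n) φ.symm x) :=
    mfderiv_comp x ((mdifferentiable_of_mem_maximalAtlas hφ').mdifferentiableAt hx')
      ((mdifferentiable_of_mem_maximalAtlas hφ).mdifferentiableAt_symm hx)
  rw [mfderiv_eq_fderiv] at hchain
  rw [hchain]
  rfl

theorem ConeApprox.ofChart {σ ε : ℝ} {g h : TensorField n M} {F : E n → E n →L[ℝ] E n →L[ℝ] ℝ}
    (hφ : φ ∈ IsManifold.maximalAtlas (𝓡 n) ∞ M) {p : M} (hp : p ∈ φ.source)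
    (hF : ConeApprox σ ε (inChart g φ (φ p)) (inChart h φ (φ p)) (F (φ p))) :
    ConeApprox σ ε (g p) (h p) (ofChart F φ p) := by
  rw [← ofChart_inChart g hφ hp, ← ofChart_inChart h hφ hp]
  exact hF.pull ((mdifferentiable_of_mem_maximalAtlas hφ).mfderiv hp)

theorem TensorField.IsLorentzian.inChart {g : TensorField n M} (hg : g.IsLorentzian)
    (hφ : φ ∈ IsManifold.maximalAtlas (𝓡 n) ∞ M) {x : E n} (hx : x ∈ φ.target) :
    IsLorentzForm (inChart g φ x) :=
  IsLorentzForm.pull (hg (φ.symm x)) ((mdifferentiable_of_mem_maximalAtlas hφ).symm.mfderiv hx)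

theorem inChart_pos {h : TensorField n M} (hh : ∀ p, ∀ w ≠ 0, 0 < h p w w)
    (hφ : φ ∈ IsManifold.maximalAtlas (𝓡 n) ∞ M) {x : E n} (hx : x ∈ φ.target) {w : E n}
    (hw : w ≠ 0) : 0 < inChart h φ x w w :=
  hh _ _ (((mdifferentiable_of_mem_maximalAtlas hφ).symm.mfderiv hx).map_ne_zero_iff.2 hw)

end Charts

section TensorBundle

variable {n : ℕ} {M : Type*} [TopologicalSpace M] [ChartedSpace (E n) M] [IsManifold (𝓡 n) ∞ M]

theorem trivializationAt_cotangent_apply {p₀ p : M} (l : TangentSpace (𝓡 n) p →L[ℝ] ℝ) (v : E n) :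
    (trivializationAt (E n →L[ℝ] ℝ)
      (fun p : M => TangentSpace (𝓡 n) p →L[ℝ] Bundle.Trivial M ℝ p) p₀ ⟨p, l⟩).2 v =
      l ((trivializationAt (E n) (TangentSpace (𝓡 n) : M → Type _) p₀).symmL ℝ p v) := by
  rw [hom_trivializationAt_apply]
  simp [ContinuousLinearMap.inCoordinates]

theorem trivializationAt_apply_snd (b : TensorField n M) (p₀ : M) {p : M}
    (hp : p ∈ (chartAt (E n) p₀).source) :
    (trivializationAt (E n →L[ℝ] E n →L[ℝ] ℝ) (fun p : M => BilinAt n p) p₀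
      ⟨p, b p⟩).2 = inChart b (chartAt (E n) p₀) (chartAt (E n) p₀ p) := by
  have hsymmL : (trivializationAt (E n) (TangentSpace (𝓡 n) : M → Type _) p₀).symmL ℝ p =
      mfderiv (𝓡 n) (𝓡 n) (chartAt (E n) p₀).symm (chartAt (E n) p₀ p) := by
    rw [TangentBundle.symmL_trivializationAt (I := 𝓡 n) hp, modelWithCornersSelf_coe, range_id,
      mfderivWithin_univ]
    simp only [mfld_simps]
    rfl
  have hbase : p ∈ (trivializationAt (E n →L[ℝ] ℝ)
      (fun p : M => TangentSpace (𝓡 n) p →L[ℝ] Bundle.Trivial M ℝ p) p₀).baseSet := by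
    rw [hom_trivializationAt_baseSet]
    exact ⟨hp, mem_univ _⟩
  ext u v
  rw [hom_trivializationAt_apply]
  simp only [ContinuousLinearMap.inCoordinates, ContinuousLinearMap.comp_apply]
  rw [Trivialization.continuousLinearMapAt_apply, Trivialization.coe_linearMapAt_of_mem _ hbase]
  refine (trivializationAt_cotangent_apply _ v).trans ?_
  rw [hsymmL]
  exact b.apply_congr ((chartAt (E n) p₀).left_inv hp).symm _ _

theorem TensorField.IsContinuous.continuousOn_inChart {g : TensorField n M} (hg : g.IsContinuous)
    (p₀ : M) : ContinuousOn (inChart g (chartAt (E n) p₀)) (chartAt (E n) p₀).target := by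
  set φ := chartAt (E n) p₀
  set e := trivializationAt (E n →L[ℝ] E n →L[ℝ] ℝ) (fun p : M => BilinAt n p) p₀ with he
  have hsource : ∀ p ∈ φ.source, (⟨p, g p⟩ :
      TotalSpace (E n →L[ℝ] E n →L[ℝ] ℝ) (fun p : M => BilinAt n p)) ∈ e.source := by
    intro p hp
    rw [e.mem_source, he, hom_trivializationAt_baseSet, hom_trivializationAt_baseSet]
    exact ⟨hp, hp, mem_univ _⟩
  have hcont : ContinuousOn (fun p => (e ⟨p, g p⟩).2) φ.source :=
    (continuous_snd.comp_continuousOn e.continuousOn).comp hg.continuousOn hsource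
  refine (hcont.comp φ.continuousOn_symm fun x hx => φ.map_target hx).congr fun x hx => ?_
  rw [Function.comp_apply, trivializationAt_apply_snd g p₀ (φ.map_target hx), φ.right_inv hx]

theorem smoothFamily_of_contDiffAt_inChart {g : ℝ → TensorField n M}
    (hg : ∀ p₀ : M, ∀ ε > 0, ContDiffAt ℝ ∞
      (fun q : ℝ × E n => inChart (g q.1) (chartAt (E n) p₀) q.2) (ε, chartAt (E n) p₀ p₀)) :
    SmoothFamily g := by
  rintro ⟨ε, p₀⟩ ⟨hε, -⟩
  refine ContMDiffAt.contMDiffWithinAt ?_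
  rw [contMDiffAt_totalSpace]
  refine ⟨contMDiffAt_snd, ?_⟩
  have hchart : ContMDiffAt (𝓘(ℝ, ℝ).prod (𝓡 n)) 𝓘(ℝ, ℝ × E n) ∞
      (fun q : ℝ × M => (q.1, chartAt (E n) p₀ q.2)) (ε, p₀) :=
    contMDiffAt_fst.prodMk_space (ContMDiffAt.comp (ε, p₀)
      (contMDiffAt_of_mem_maximalAtlas (IsManifold.chart_mem_maximalAtlas p₀)
        (mem_chart_source _ p₀)) contMDiffAt_snd)
  refine ((hg p₀ ε hε).contMDiffAt.comp (ε, p₀) hchart).congr_of_eventuallyEq ?_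
  filter_upwards [continuousAt_snd.eventually_mem ((chartAt (E n) p₀).open_source.mem_nhds
    (mem_chart_source _ p₀))] with q hq
  exact trivializationAt_apply_snd (g q.1) p₀ hq

theorem SmoothFamily.isSmooth {g : ℝ → TensorField n M} (hg : SmoothFamily g) {ε : ℝ} (hε : 0 < ε) :
    (g ε).IsSmooth := by
  intro p
  have hε' : ((ε, p) : ℝ × M) ∈ Ioi (0 : ℝ) ×ˢ (univ : Set M) := ⟨hε, mem_univ p⟩
  exact ((hg (ε, p) hε').contMDiffAt ((isOpen_Ioi.prod isOpen_univ).mem_nhds hε')).comp p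
    (f := fun p : M => (ε, p)) (contMDiffAt_const.prodMk contMDiffAt_id)

end TensorBundle

section LocalConeApproximation

variable {ι V W : Type*} [NormedAddCommGroup V] [NormedSpace ℝ V]
  [NormedAddCommGroup W] [NormedSpace ℝ W] {δ δ' : ι → ℝ} {x : V}

theorem cmBoundedAt_smul_const (hδ : ∀ i, 0 ≤ δ i) (w : W) {m : ℕ} :
    CmBoundedAt m δ (fun i _ => δ i • w) x := by
  refine ⟨‖w‖₊, Eventually.of_forall fun y i => ⟨contDiffAt_const, fun j _ => ?_⟩⟩
  rcases eq_or_ne j 0 with rfl | hj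
  · rw [norm_iteratedFDeriv_zero, norm_smul, Real.norm_of_nonneg (hδ i), mul_comm, coe_nnnorm]
  · rw [iteratedFDeriv_const_of_ne hj, Pi.zero_apply, norm_zero]
    exact mul_nonneg (NNReal.coe_nonneg _) (hδ i)

theorem C1ApproxAt.add_smul_const {F : ι → V → W} {G : V → W} (hF : C1ApproxAt δ' F G x)
    (hδ' : ∀ i, δ' i ≤ δ i) (hδ : ∀ i, 0 ≤ δ i) (hδ₁ : ∀ i, δ i ≤ 1) (w : W) :
    C1ApproxAt δ (fun i y => F i y + δ i • w) G x := by
  refine ⟨((hF.1.mono hδ').add (cmBoundedAt_smul_const hδ w)).congr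
    (Eventually.of_forall fun y i => ?_), hF.2.add ((cmBoundedAt_smul_const hδ w).mono hδ₁)⟩
  rw [add_sub_right_comm]

theorem exists_local_coneApprox [FiniteDimensional ℝ V] {σ : ℝ} (hσ : |σ| = 1) {U : Set V}
    (hU : IsOpen U) {x₀ : V} (hx₀ : x₀ ∈ U) {g h : V → V →L[ℝ] V →L[ℝ] ℝ}
    (hg : ContinuousOn g U) (hh : ContinuousOn h U) (hg_lor : ∀ x ∈ U, IsLorentzForm (g x))
    (hh_pos : ∀ w ≠ 0, 0 < h x₀ w w) (hδ : ∀ i, 0 < δ i) (hδ₁ : ∀ i, δ i ≤ 1) :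
    ∃ s ∈ 𝓝 x₀, ∃ F : ι → V → V →L[ℝ] V →L[ℝ] ℝ, (∀ i, ContDiff ℝ ∞ (F i)) ∧
      (∀ i, ∀ x ∈ s, ConeApprox σ (δ i) (g x) (h x) (F i x)) ∧
      (C11On g U → ∀ x ∈ s, C1ApproxAt δ F g x) := by
  obtain ⟨q, κ, hκ, hq, hcone⟩ := exists_coneApprox_nhds hσ (hg_lor x₀ hx₀) hh_pos
  have hmin : ∀ i, min κ 1 * δ i ≤ δ i := fun i =>
    mul_le_of_le_one_left (hδ i).le (min_le_right _ _)
  -- Mollification commutes with `flip`, hence preserves symmetry.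
  let flip : (V →L[ℝ] V →L[ℝ] ℝ) →L[ℝ] (V →L[ℝ] V →L[ℝ] ℝ) :=
    (ContinuousLinearMap.flipₗᵢ ℝ V V ℝ).toContinuousLinearEquiv
  obtain ⟨s, hs, F, hF, hsymm, hclose, hF₁⟩ := exists_local_approx hU hg hx₀ (A := flip)
    (fun x hx => ContinuousLinearMap.ext fun X => ContinuousLinearMap.ext fun Y =>
      (hg_lor x hx).1 Y X)
    (fun i => mul_pos (lt_min hκ one_pos) (hδ i)) (fun i => (hmin i).trans (hδ₁ i))
  have hgh : ContinuousAt (fun x => (g x, h x)) x₀ :=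
    (hg.continuousAt (hU.mem_nhds hx₀)).prodMk (hh.continuousAt (hU.mem_nhds hx₀))
  refine ⟨s ∩ {x | _}, inter_mem hs (hgh.eventually hcone), fun i x => F i x + δ i • q,
    fun i => (hF i).add contDiff_const, fun i x ⟨hx, hconex⟩ => ?_,
    fun hC x hx => (hF₁ hC x hx.1).add_smul_const hmin (fun i => (hδ i).le) hδ₁ q⟩
  refine hconex (δ i) _ (hδ i) (hδ₁ i) (fun X Y => ?_) ?_
  · have hFsymm : F i x Y X = F i x X Y := DFunLike.congr_fun (congrArg (· X) (hsymm i x)) Y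
    simp only [add_apply, smul_apply, hq X Y, hFsymm]
  · rw [add_sub_add_right_eq_sub]
    exact (hclose i x hx).trans (mul_le_mul_of_nonneg_right (min_le_left _ _) (hδ i).le)

end LocalConeApproximation

section Gluing

variable {V V' : Type*} [NormedAddCommGroup V] [NormedSpace ℝ V] [NormedAddCommGroup V']
  [NormedSpace ℝ V']

/-- The pullback of bilinear forms along `A`, as a continuous linear operator. -/
def pullCLM (A : V →L[ℝ] V') : (V' →L[ℝ] V' →L[ℝ] ℝ) →L[ℝ] (V →L[ℝ] V →L[ℝ] ℝ) :=
  (ContinuousLinearMap.compL ℝ V (V' →L[ℝ] ℝ) (V →L[ℝ] ℝ)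
    ((ContinuousLinearMap.compL ℝ V V' ℝ).flip A)).comp
      ((ContinuousLinearMap.compL ℝ V V' (V' →L[ℝ] ℝ)).flip A)

theorem contDiff_pullCLM : ContDiff ℝ ∞ (pullCLM (V := V) (V' := V')) :=
  ((ContinuousLinearMap.contDiff _).comp (ContinuousLinearMap.contDiff _)).clm_comp
    (ContinuousLinearMap.contDiff _)

theorem CmBoundedAt.sum_clm_apply_comp {ι κ W W' : Type*} [NormedAddCommGroup W] [NormedSpace ℝ W]
    [NormedAddCommGroup W'] [NormedSpace ℝ W'] {m : ℕ} {c : ι → ℝ} {x : V} {s : Finset κ}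
    {a : κ → V → W →L[ℝ] W'} {ψ : κ → V → V'} {u : κ → ι → V' → W}
    (ha : ∀ k ∈ s, ContDiffAt ℝ m (a k) x) (hψ : ∀ k ∈ s, ContDiffAt ℝ m (ψ k) x)
    (hu : ∀ k ∈ s, CmBoundedAt m c (u k) (ψ k x)) :
    CmBoundedAt m c (fun i y => ∑ k ∈ s, a k y (u k i (ψ k y))) x :=
  .sum fun k hk => by
    simpa only [one_mul] using (cmBoundedAt_const (ha k hk)).clm_apply ((hu k hk).comp (hψ k hk))

variable {n : ℕ} {M : Type*} [TopologicalSpace M] [ChartedSpace (E n) M]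

/-- The tensor field patched by the partition of unity `χ` from the fields `F i` of bilinear forms
in the preferred charts at the points `i` of `M`. -/
def glue (χ : SmoothPartitionOfUnity M (𝓡 n) M univ) (F : M → E n → E n →L[ℝ] E n →L[ℝ] ℝ) :
    TensorField n M := fun p => ∑ᶠ i, χ i p • ofChart (F i) (chartAt (E n) i) p

/-- The operator by which the `i`-th summand of `glue χ F` acts on `F i` in the chart `φ`. -/
def glueCoeff (χ : SmoothPartitionOfUnity M (𝓡 n) M univ) (φ : OpenPartialHomeomorph M (E n))
    (i : M) (x : E n) : (E n →L[ℝ] E n →L[ℝ] ℝ) →L[ℝ] (E n →L[ℝ] E n →L[ℝ] ℝ) :=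
  χ i (φ.symm x) • pullCLM (fderiv ℝ (chartAt (E n) i ∘ φ.symm) x)

variable [IsManifold (𝓡 n) ∞ M] {χ : SmoothPartitionOfUnity M (𝓡 n) M univ}
  {φ : OpenPartialHomeomorph M (E n)} {x : E n}

theorem glue_inChart (hχ : χ.IsSubordinate fun i => (chartAt (E n) i).source)
    (g : TensorField n M) : glue χ (fun i => inChart g (chartAt (E n) i)) = g := by
  funext p
  have hterm : ∀ i, χ i p • ofChart (inChart g (chartAt (E n) i)) (chartAt (E n) i) p =
      χ i p • g p := by
    intro i
    by_cases hi : χ i p = 0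
    · simp only [hi, zero_smul]
    · rw [ofChart_inChart g (IsManifold.chart_mem_maximalAtlas i) (hχ i (subset_tsupport _ hi))]
  rw [glue, finsum_congr hterm, ← χ.sum_finsupport_smul_eq_finsum p (fun _ _ => g p),
    ← Finset.sum_smul, χ.sum_finsupport p (mem_univ p), one_smul]

theorem coneApprox_glue {σ ε : ℝ} {g h : TensorField n M} {U : M → Set (E n)}
    (hχ : χ.IsSubordinate fun i => (chartAt (E n) i).source ∩ chartAt (E n) i ⁻¹' U i)
    {F : M → E n → E n →L[ℝ] E n →L[ℝ] ℝ}
    (hF : ∀ i, ∀ x ∈ U i, ConeApprox σ ε (inChart g (chartAt (E n) i) x)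
      (inChart h (chartAt (E n) i) x) (F i x)) (p : M) :
    ConeApprox σ ε (g p) (h p) (glue χ F p) := by
  refine convex_coneApprox.finsum_mem (fun i => χ.nonneg i p) (χ.sum_eq_one (mem_univ p))
    fun i hi => ?_
  obtain ⟨hsource, hU⟩ := hχ i (subset_tsupport _ hi)
  exact ConeApprox.ofChart (IsManifold.chart_mem_maximalAtlas i) hsource (hF i _ hU)

theorem contDiffAt_transition (hχ : χ.IsSubordinate fun i => (chartAt (E n) i).source)
    (hφ : φ ∈ IsManifold.maximalAtlas (𝓡 n) ∞ M) (hx : x ∈ φ.target) {i : M}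
    (hi : i ∈ χ.fintsupport (φ.symm x)) : ContDiffAt ℝ ∞ (chartAt (E n) i ∘ φ.symm) x :=
  (contDiffOn_transition hφ (IsManifold.chart_mem_maximalAtlas i)).contDiffAt
    ((φ.isOpen_inter_preimage_symm (chartAt (E n) i).open_source).mem_nhds
      ⟨hx, hχ i ((χ.mem_fintsupport_iff _ i).1 hi)⟩)

theorem contDiffAt_glueCoeff (hχ : χ.IsSubordinate fun i => (chartAt (E n) i).source)
    (hφ : φ ∈ IsManifold.maximalAtlas (𝓡 n) ∞ M) (hx : x ∈ φ.target) {i : M}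
    (hi : i ∈ χ.fintsupport (φ.symm x)) : ContDiffAt ℝ ∞ (glueCoeff χ φ i) x := by
  have hsymm : ContMDiffAt (𝓡 n) (𝓡 n) ∞ φ.symm x := contMDiffAt_symm_of_mem_maximalAtlas hφ hx
  have hpull : ContDiffAt ℝ ∞ (fun y => pullCLM (fderiv ℝ (chartAt (E n) i ∘ φ.symm) y)) x :=
    (contDiff_pullCLM (V := E n) (V' := E n)).contDiffAt.comp x
      ((contDiffAt_transition hχ hφ hx hi).fderiv_right le_rfl)
  exact (contMDiffAt_iff_contDiffAt.1 ((χ i).contMDiff.contMDiffAt.comp x hsymm)).smul hpull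

theorem eventually_inChart_glue (hχ : χ.IsSubordinate fun i => (chartAt (E n) i).source)
    (hφ : φ ∈ IsManifold.maximalAtlas (𝓡 n) ∞ M) (hx : x ∈ φ.target) :
    ∀ᶠ y in 𝓝 x, ∀ F, inChart (glue χ F) φ y = ∑ i ∈ χ.fintsupport (φ.symm x),
      glueCoeff χ φ i y (F i ((chartAt (E n) i ∘ φ.symm) y)) := by
  have hsource : ∀ᶠ y in 𝓝 x, ∀ i ∈ χ.fintsupport (φ.symm x),
      φ.symm y ∈ (chartAt (E n) i).source :=
    (Filter.eventually_all_finset _).2 fun i hi => (φ.continuousAt_symm hx).eventually_mem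
      ((chartAt (E n) i).open_source.mem_nhds (hχ i ((χ.mem_fintsupport_iff _ i).1 hi)))
  filter_upwards [hsource, (φ.continuousAt_symm hx).eventually (χ.eventually_finsupport_subset _),
    φ.open_target.mem_nhds hx] with y hsource hsubset hy F
  have hglue : glue χ F (φ.symm y) = ∑ i ∈ χ.fintsupport (φ.symm x),
      χ i (φ.symm y) • ofChart (F i) (chartAt (E n) i) (φ.symm y) := by
    rw [glue, ← χ.sum_finsupport_smul_eq_finsum (φ.symm y)
      (fun i _ => ofChart (F i) (chartAt (E n) i) (φ.symm y))]
    refine Finset.sum_subset hsubset fun i _ hi => ?_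
    rw [show χ i (φ.symm y) = 0 by simpa using hi, zero_smul]
  calc inChart (glue χ F) φ y
      = ∑ i ∈ χ.fintsupport (φ.symm x),
          χ i (φ.symm y) • inChart (ofChart (F i) (chartAt (E n) i)) φ y := by
        rw [inChart, hglue]
        exact pull_sum_smul _ _ _ _
    _ = _ := Finset.sum_congr rfl fun i hi => by
        rw [inChart_ofChart (F i) hφ (IsManifold.chart_mem_maximalAtlas i) hy (hsource i hi)]
        rfl

theorem contDiffAt_inChart_glue (hχ : χ.IsSubordinate fun i => (chartAt (E n) i).source)
    (hφ : φ ∈ IsManifold.maximalAtlas (𝓡 n) ∞ M) (hx : x ∈ φ.target)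
    {F : M → E n → E n →L[ℝ] E n →L[ℝ] ℝ} (hF : ∀ i, ContDiff ℝ ∞ (F i)) :
    ContDiffAt ℝ ∞ (inChart (glue χ F) φ) x :=
  ContDiffAt.congr_of_eventuallyEq (ContDiffAt.sum fun i hi =>
    (contDiffAt_glueCoeff hχ hφ hx hi).clm_apply ((hF i).contDiffAt.comp x
      (contDiffAt_transition hχ hφ hx hi)))
    ((eventually_inChart_glue hχ hφ hx).mono fun _ hy => hy F)

theorem c1ApproxAt_inChart_glue {ι : Type*} {δ : ι → ℝ}
    (hχ : χ.IsSubordinate fun i => (chartAt (E n) i).source)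
    (hφ : φ ∈ IsManifold.maximalAtlas (𝓡 n) ∞ M) (hx : x ∈ φ.target)
    {F : M → ι → E n → E n →L[ℝ] E n →L[ℝ] ℝ} {G : M → E n → E n →L[ℝ] E n →L[ℝ] ℝ}
    (hF : ∀ i ∈ χ.fintsupport (φ.symm x),
      C1ApproxAt δ (F i) (G i) (chartAt (E n) i (φ.symm x))) :
    C1ApproxAt δ (fun k => inChart (glue χ fun i => F i k) φ) (inChart (glue χ G) φ) x := by
  have hsum {m : ℕ} {c : ι → ℝ} {u : M → ι → E n → E n →L[ℝ] E n →L[ℝ] ℝ}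
      (hu : ∀ i ∈ χ.fintsupport (φ.symm x),
        CmBoundedAt m c (u i) (chartAt (E n) i (φ.symm x))) :=
    CmBoundedAt.sum_clm_apply_comp (ψ := fun i => chartAt (E n) i ∘ φ.symm)
      (fun i hi => (contDiffAt_glueCoeff hχ hφ hx hi).of_le (by exact_mod_cast le_top))
      (fun i hi => (contDiffAt_transition hχ hφ hx hi).of_le (by exact_mod_cast le_top)) hu
  have hglue := eventually_inChart_glue hχ hφ hx
  refine ⟨(hsum fun i hi => (hF i hi).1).congr ?_, (hsum fun i hi => (hF i hi).2).congr ?_⟩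
  · filter_upwards [hglue] with y hy k
    simp only [hy, map_sub, Finset.sum_sub_distrib]
  · filter_upwards [hglue] with y hy k
    exact (hy _).symm

theorem exists_smooth_coneApprox [T2Space M] [SigmaCompactSpace M] {ι : Type*} {δ : ι → ℝ} {σ : ℝ}
    (hσ : |σ| = 1) {g h : TensorField n M} (hg_cont : g.IsContinuous) (hg_lor : g.IsLorentzian)
    (hh_cont : h.IsContinuous) (hh_pos : ∀ p, ∀ w ≠ 0, 0 < h p w w) (hδ : ∀ i, 0 < δ i)
    (hδ₁ : ∀ i, δ i ≤ 1) :
    ∃ γ : ι → TensorField n M,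
      (∀ i, ∀ φ ∈ IsManifold.maximalAtlas (𝓡 n) ∞ M,
        ContDiffOn ℝ ∞ (inChart (γ i) φ) φ.target) ∧
      (∀ i p, ConeApprox σ (δ i) (g p) (h p) (γ i p)) ∧
      (g.IsC11 → ∀ φ ∈ IsManifold.maximalAtlas (𝓡 n) ∞ M, ∀ x ∈ φ.target,
        C1ApproxAt δ (fun i => inChart (γ i) φ) (inChart g φ) x) := by
  choose s hs F hF hcone hF₁ using fun p : M =>
    have hp := IsManifold.chart_mem_maximalAtlas (I := 𝓡 n) (n := ∞) p
    exists_local_coneApprox hσ (chartAt (E n) p).open_target (mem_chart_target (E n) p)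
      (hg_cont.continuousOn_inChart p) (hh_cont.continuousOn_inChart p)
      (fun x hx => hg_lor.inChart hp hx)
      (fun w hw => inChart_pos hh_pos hp (mem_chart_target (E n) p) hw) hδ hδ₁
  obtain ⟨χ, hχ⟩ := SmoothPartitionOfUnity.exists_isSubordinate (𝓡 n) (isClosed_univ (X := M))
    (fun i => (chartAt (E n) i).source ∩ chartAt (E n) i ⁻¹' interior (s i))
    (fun i => (chartAt (E n) i).isOpen_inter_preimage isOpen_interior)
    (fun p _ => mem_iUnion.2 ⟨p, mem_chart_source (E n) p, mem_interior_iff_mem_nhds.2 (hs p)⟩)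
  have hχ' : χ.IsSubordinate fun i => (chartAt (E n) i).source := fun i =>
    (hχ i).trans inter_subset_left
  refine ⟨fun k => glue χ fun i => F i k, fun k φ hφ x hx => ?_, fun k => ?_,
    fun hg φ hφ x hx => ?_⟩
  · exact (contDiffAt_inChart_glue hχ' hφ hx fun i => hF i k).contDiffWithinAt
  · exact coneApprox_glue hχ fun i x hx => hcone i k x (interior_subset hx)
  · rw [← glue_inChart hχ' g]
    refine c1ApproxAt_inChart_glue hχ' hφ hx fun i hi => ?_
    exact hF₁ i (hg.c11On_inChart (IsManifold.chart_mem_maximalAtlas i)) _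
      (interior_subset (hχ i ((χ.mem_fintsupport_iff _ i).1 hi)).2)

end Gluing

section Interpolation

variable {W : Type*} [AddCommGroup W] [Module ℝ W]

/-- The smooth path through the points of the sequence `w`: it equals `w k` at time `k`, and it is
constantly `w 0` at negative times. -/
def interp (w : ℕ → W) (t : ℝ) : W :=
  w ⌊t⌋₊ + Real.smoothTransition (t - ⌊t⌋₊) • (w (⌊t⌋₊ + 1) - w ⌊t⌋₊)

theorem interp_sub_const (w : ℕ → W) (a : W) (t : ℝ) :
    interp (fun k => w k - a) t = interp w t - a := by
  simp only [interp, sub_sub_sub_cancel_right]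
  abel

theorem interp_mem {w : ℕ → W} {t : ℝ} {S : Set W} (hS : Convex ℝ S) (h₀ : w ⌊t⌋₊ ∈ S)
    (h₁ : w (⌊t⌋₊ + 1) ∈ S) : interp w t ∈ S :=
  hS.add_smul_sub_mem h₀ h₁ ⟨Real.smoothTransition.nonneg _, Real.smoothTransition.le_one _⟩

theorem interp_eq_sum (w : ℕ → W) {t : ℝ} {N : ℕ} (hN : ⌊t⌋₊ < N) :
    interp w t =
      w 0 + ∑ k ∈ Finset.range N, Real.smoothTransition (t - k) • (w (k + 1) - w k) := by
  obtain ⟨d, rfl⟩ := Nat.exists_eq_add_of_lt hN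
  have hbefore : ∑ k ∈ Finset.range ⌊t⌋₊, Real.smoothTransition (t - k) • (w (k + 1) - w k) =
      w ⌊t⌋₊ - w 0 := by
    rw [← Finset.sum_range_sub]
    refine Finset.sum_congr rfl fun k hk => ?_
    have hkt : ((k + 1 : ℕ) : ℝ) ≤ t :=
      (Nat.le_floor_iff' k.succ_ne_zero).1 (Finset.mem_range.1 hk)
    push_cast at hkt
    rw [Real.smoothTransition.one_of_one_le (by linarith), one_smul]
  have hafter : ∑ k ∈ Finset.range d, Real.smoothTransition (t - (⌊t⌋₊ + 1 + k : ℕ)) •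
      (w (⌊t⌋₊ + 1 + k + 1) - w (⌊t⌋₊ + 1 + k)) = 0 := by
    refine Finset.sum_eq_zero fun k _ => ?_
    have hkt : t < (⌊t⌋₊ + 1 + k : ℕ) := by
      push_cast
      linarith [Nat.lt_floor_add_one t, (Nat.cast_nonneg k : (0 : ℝ) ≤ k)]
    rw [Real.smoothTransition.zero_of_nonpos (sub_nonpos.2 hkt.le), zero_smul]
  rw [add_right_comm, Finset.sum_range_add, Finset.sum_range_succ, hbefore, hafter, interp]
  abel

end Interpolation

section InterpolationOfFunctions

variable {ι V W : Type*} [NormedAddCommGroup V] [NormedSpace ℝ V]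
  [NormedAddCommGroup W] [NormedSpace ℝ W] {x : V}

theorem contDiffAt_interp {F : ℕ → V → W} {t : ℝ} (hF : ∀ k, ContDiffAt ℝ ∞ (F k) x) :
    ContDiffAt ℝ ∞ (fun q : ℝ × V => interp (fun k => F k q.2) q.1) (t, x) := by
  have hsum : ∀ᶠ q : ℝ × V in 𝓝 (t, x), interp (fun k => F k q.2) q.1 =
      F 0 q.2 + ∑ k ∈ Finset.range (⌊t⌋₊ + 1), Real.smoothTransition (q.1 - k) •
        (F (k + 1) q.2 - F k q.2) := by
    filter_upwards [continuousAt_fst.eventually_lt_const (Nat.lt_floor_add_one t)] with q hq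
    exact interp_eq_sum _ ((Nat.floor_lt' (Nat.succ_ne_zero _)).2 (by exact_mod_cast hq))
  have hF' : ∀ k, ContDiffAt ℝ ∞ (fun q : ℝ × V => F k q.2) (t, x) := fun k =>
    (hF k).comp (t, x) contDiffAt_snd
  refine ContDiffAt.congr_of_eventuallyEq ((hF' 0).add (ContDiffAt.sum fun k _ =>
    ContDiffAt.smul ?_ ((hF' (k + 1)).sub (hF' k)))) hsum
  exact Real.smoothTransition.contDiffAt.comp (t, x) (contDiffAt_fst.sub contDiffAt_const)

theorem convex_setOf_norm_iteratedFDeriv_le (m : ℕ) (x : V) (r : ℝ) :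
    Convex ℝ {f : V → W | ContDiffAt ℝ m f x ∧ ∀ j ≤ m, ‖iteratedFDeriv ℝ j f x‖ ≤ r} := by
  rintro f₁ ⟨hf₁, hr₁⟩ f₂ ⟨hf₂, hr₂⟩ a b ha hb hab
  refine ⟨(hf₁.const_smul a).add (hf₂.const_smul b), fun j hj => ?_⟩
  have hjm : (j : WithTop ℕ∞) ≤ m := by exact_mod_cast hj
  have haf : ContDiffAt ℝ j (a • f₁) x := (hf₁.of_le hjm).const_smul a
  have hbf : ContDiffAt ℝ j (b • f₂) x := (hf₂.of_le hjm).const_smul b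
  rw [iteratedFDeriv_add_apply haf hbf, iteratedFDeriv_const_smul_apply (hf₁.of_le hjm),
    iteratedFDeriv_const_smul_apply (hf₂.of_le hjm)]
  simpa using convex_closedBall (0 : V [×j]→L[ℝ] W) r (by simpa using hr₁ j hj)
    (by simpa using hr₂ j hj) ha hb hab

theorem CmBoundedAt.interp {m : ℕ} {c : ℕ → ℝ} {d : ι → ℝ} {u : ℕ → V → W}
    (hu : CmBoundedAt m c u x) (hc : Antitone c) {t : ι → ℝ} (hcd : ∀ i, c ⌊t i⌋₊ ≤ d i) :
    CmBoundedAt m d (fun i y => interp (fun k => u k y) (t i)) x := by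
  obtain ⟨C, hC⟩ := hu
  refine ⟨C, hC.mono fun y hy i => ?_⟩
  refine interp_mem (convex_setOf_norm_iteratedFDeriv_le m y (C * d i)) (w := u)
    ⟨(hy _).1, fun j hj => ((hy _).2 j hj).trans ?_⟩
    ⟨(hy _).1, fun j hj => ((hy _).2 j hj).trans ?_⟩
  · exact mul_le_mul_of_nonneg_left (hcd i) C.coe_nonneg
  · exact mul_le_mul_of_nonneg_left ((hc (Nat.le_succ _)).trans (hcd i)) C.coe_nonneg

theorem C1ApproxAt.interp {δ : ℕ → ℝ} {d : ι → ℝ} {F : ℕ → V → W} {G : V → W}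
    (hF : C1ApproxAt δ F G x) (hδ : Antitone δ) {t : ι → ℝ} (hd : ∀ i, δ ⌊t i⌋₊ ≤ d i) :
    C1ApproxAt d (fun i y => interp (fun k => F k y) (t i)) G x :=
  ⟨(hF.1.interp hδ hd).congr (Eventually.of_forall fun _ _ => interp_sub_const _ _ _),
    hF.2.interp antitone_const fun _ => le_rfl⟩

end InterpolationOfFunctions

section ApproximatingFamilies

variable {n : ℕ} {M : Type*} [TopologicalSpace M] [ChartedSpace (E n) M]

theorem CmBoundedAt.entryCLM {ι : Type*} {m : ℕ} {c : ι → ℝ}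
    {u : ι → E n → E n →L[ℝ] E n →L[ℝ] ℝ} {x : E n} (hu : CmBoundedAt m c u x) :
    CmBoundedAt m (fun k : ι × Fin n × Fin n => c k.1)
      (fun k y => LorentzApprox.entryCLM k.2.1 k.2.2 (u k.1 y)) x := by
  obtain ⟨C, hC⟩ := hu
  refine ⟨C, hC.mono fun y hy k => ⟨?_, fun j hj => ?_⟩⟩
  · exact (ContinuousLinearMap.contDiff _).contDiffAt.comp y (hy k.1).1
  · exact ((ContinuousLinearMap.norm_iteratedFDeriv_comp_left _ (hy k.1).1
      (by exact_mod_cast hj)).trans (mul_le_of_le_one_left (norm_nonneg _)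
        (norm_entryCLM_le _ _))).trans ((hy k.1).2 j hj)

theorem tendstoUniformlyOn_of_norm_sub_le {X Y : Type*} [SeminormedAddCommGroup Y]
    {f : ℝ → X → Y} {f₀ : X → Y} {K : Set X} {C : ℝ}
    (h : ∀ ε > 0, ∀ x ∈ K, ‖f ε x - f₀ x‖ ≤ C * ε) : TendstoUniformlyOn f f₀ (𝓝[>] 0) K := by
  have hlim : Tendsto (fun ε : ℝ => C * ε) (𝓝[>] 0) (𝓝 0) :=
    tendsto_nhdsWithin_of_tendsto_nhds (Continuous.tendsto' (by fun_prop) _ _ (mul_zero C))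
  refine Metric.tendstoUniformlyOn_iff.2 fun r hr => ?_
  filter_upwards [hlim.eventually_lt_const hr, self_mem_nhdsWithin] with ε hε hpos x hx
  rw [dist_comm, dist_eq_norm]
  exact (h ε hpos x hx).trans_lt hε

variable {gε : ℝ → TensorField n M} {g : TensorField n M} {δ : Ioi (0 : ℝ) → ℝ}

theorem convergesC1_of_c1ApproxAt (h : ∀ φ ∈ IsManifold.maximalAtlas (𝓡 n) ∞ M, ∀ x ∈ φ.target,
    C1ApproxAt (fun ε : Ioi (0 : ℝ) => (ε : ℝ)) (fun ε => inChart (gε ε) φ) (inChart g φ) x) :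
    ConvergesC1 gε g := by
  intro φ hφ K hK hKφ i j
  obtain ⟨C, hC⟩ := exists_cmBound_of_isCompact hK (fun k => k.1.2.le)
    fun x hx => (h φ hφ x (hKφ hx)).1.entryCLM
  have hsub : ∀ ε, (fun y => entryCLM i j (inChart (gε ε) φ y - inChart g φ y)) =
      fun y => component (gε ε) φ i j y - component g φ i j y := fun ε => by
    simp only [map_sub, entryCLM_inChart]
  refine ⟨tendstoUniformlyOn_of_norm_sub_le (C := C) fun ε hε x hx => ?_,
    tendstoUniformlyOn_of_norm_sub_le (C := C) fun ε hε x hx => ?_⟩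
  · have hbound := hC x hx (⟨ε, hε⟩, i, j) 0 zero_le_one
    rwa [norm_iteratedFDeriv_zero, congrFun (hsub ε) x] at hbound
  · have hbound := hC x hx (⟨ε, hε⟩, i, j) 1 le_rfl
    have hgε : DifferentiableAt ℝ (component (gε ε) φ i j) x :=
      ((h φ hφ x (hKφ hx)).2.entryCLM.contDiffAt (⟨ε, hε⟩, i, j)).differentiableAt two_ne_zero
    have hg : DifferentiableAt ℝ (component g φ i j) x := by
      have hdiff : DifferentiableAt ℝ (fun y => component (gε ε) φ i j y - component g φ i j y) x :=
        hsub ε ▸ ((h φ hφ x (hKφ hx)).1.entryCLM.contDiffAt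
          (⟨ε, hε⟩, i, j)).differentiableAt one_ne_zero
      simpa only [sub_sub_cancel] using hgε.fun_sub hdiff
    rwa [norm_iteratedFDeriv_one, hsub ε, fderiv_fun_sub hgε hg] at hbound

theorem secondDerivBounded_of_c1ApproxAt (h : ∀ φ ∈ IsManifold.maximalAtlas (𝓡 n) ∞ M,
    ∀ x ∈ φ.target, C1ApproxAt δ (fun ε => inChart (gε ε) φ) (inChart g φ) x) :
    SecondDerivBounded gε := by
  intro φ hφ K hK hKφ
  obtain ⟨C, hC⟩ := exists_cmBound_of_isCompact hK (fun _ => zero_le_one)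
    fun x hx => (h φ hφ x (hKφ hx)).2.entryCLM
  exact ⟨C, fun ε hε x hx i j => (hC x hx (⟨ε, hε⟩, i, j) 2 le_rfl).trans_eq (mul_one _)⟩

variable [IsManifold (𝓡 n) ∞ M]

theorem smoothFamily_interp {γ : ℕ → TensorField n M}
    (hγ : ∀ k, ∀ φ ∈ IsManifold.maximalAtlas (𝓡 n) ∞ M,
      ContDiffOn ℝ ∞ (inChart (γ k) φ) φ.target) {t : ℝ → ℝ} (ht : ContDiffOn ℝ ∞ t (Ioi 0)) :
    SmoothFamily fun ε p => interp (fun k => γ k p) (t ε) := by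
  refine smoothFamily_of_contDiffAt_inChart fun p₀ ε hε => ?_
  have hchart : ∀ k, ContDiffAt ℝ ∞ (inChart (γ k) (chartAt (E n) p₀)) (chartAt (E n) p₀ p₀) :=
    fun k => (hγ k _ (IsManifold.chart_mem_maximalAtlas p₀)).contDiffAt
      ((chartAt (E n) p₀).open_target.mem_nhds (mem_chart_target (E n) p₀))
  have ht' : ContDiffAt ℝ ∞ (fun q : ℝ × E n => (t q.1, q.2)) (ε, chartAt (E n) p₀ p₀) :=
    ((ht.contDiffAt (Ioi_mem_nhds hε)).comp (ε, chartAt (E n) p₀ p₀) contDiffAt_fst).prodMk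
      contDiffAt_snd
  exact (contDiffAt_interp hchart).comp (ε, chartAt (E n) p₀ p₀) ht'

theorem exists_smoothFamily_coneApprox [T2Space M] [SigmaCompactSpace M] {σ : ℝ} (hσ : |σ| = 1)
    {g h : TensorField n M} (hg_cont : g.IsContinuous) (hg_lor : g.IsLorentzian)
    (hh_cont : h.IsContinuous) (hh_pos : ∀ p, ∀ w ≠ 0, 0 < h p w w) :
    ∃ gε : ℝ → TensorField n M, SmoothFamily gε ∧
      (∀ ε > 0, ∀ p, ConeApprox σ (ε / 3) (g p) (h p) (gε ε p)) ∧
      (g.IsC11 → ConvergesC1 gε g ∧ SecondDerivBounded gε) := by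
  have hδ_anti : Antitone fun k : ℕ => 1 / ((k : ℝ) + 1) := fun _ _ hkl =>
    Nat.one_div_le_one_div hkl
  have hδ_floor : ∀ ε > (0 : ℝ), 1 / ((⌊3 / ε⌋₊ : ℝ) + 1) ≤ ε / 3 := fun ε hε => by
    rw [← one_div_div 3 ε]
    exact one_div_le_one_div_of_le (by positivity) (Nat.lt_floor_add_one _).le
  obtain ⟨γ, hγ, hcone, hC1⟩ := exists_smooth_coneApprox (δ := fun k : ℕ => 1 / ((k : ℝ) + 1))
    hσ hg_cont hg_lor hh_cont hh_pos (fun _ => Nat.one_div_pos_of_nat)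
    fun k => (hδ_anti k.zero_le).trans_eq (by simp)
  refine ⟨fun ε p => interp (fun k => γ k p) (3 / ε), smoothFamily_interp hγ
    (contDiffOn_const.div contDiffOn_id fun ε hε => hε.ne'), fun ε hε p => ?_, fun hg => ?_⟩
  · refine interp_mem convex_coneApprox ((hcone _ p).mono (hδ_floor ε hε)) ((hcone _ p).mono ?_)
    exact (hδ_anti (Nat.le_succ _)).trans (hδ_floor ε hε)
  · have happrox : ∀ φ ∈ IsManifold.maximalAtlas (𝓡 n) ∞ M, ∀ x ∈ φ.target,
        C1ApproxAt (fun ε : Ioi (0 : ℝ) => (ε : ℝ))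
          (fun ε y => interp (fun k => inChart (γ k) φ y) (3 / ε)) (inChart g φ) x :=
      fun φ hφ x hx => (hC1 hg φ hφ x hx).interp hδ_anti fun ε =>
        (hδ_floor ε ε.2).trans (div_le_self ε.2.le (by norm_num))
    exact ⟨convergesC1_of_c1ApproxAt happrox, secondDerivBounded_of_c1ApproxAt happrox⟩

theorem distWrt_le {h : ContMDiffRiemannianMetric (𝓡 n) ∞ (E n)
    (fun p : M => TangentSpace (𝓡 n) p)} {g₁ g₂ : TensorField n M} {r : ℝ}
    (hr : ∀ p, IsCloseWrt (h.inner p) r (g₁ p) (g₂ p)) : distWrt h g₁ g₂ ≤ ENNReal.ofReal r := by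
  refine iSup_le fun p => iSup₂_le fun X Y => iSup₂_le fun hX hY => ENNReal.ofReal_le_ofReal ?_
  have hX' : 0 < √(h.inner p X X) := Real.sqrt_pos.2 (h.pos p X hX)
  have hY' : 0 < √(h.inner p Y Y) := Real.sqrt_pos.2 (h.pos p Y hY)
  exact (div_le_iff₀ (mul_pos hX' hY')).2 (hr p X Y)

end ApproximatingFamilies

section ConeComparison

variable {n : ℕ} {M : Type*} [TopologicalSpace M] [ChartedSpace (E n) M] {g h b : TensorField n M}
  {ε : ℝ}

theorem strictlyLargerCones_of_coneApprox_one (hb : ∀ p, ConeApprox 1 ε (g p) (h p) (b p)) :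
    StrictlyLargerCones b g := fun p X hX hbX => by
  by_contra! hgX
  exact hbX.not_gt (by simpa only [one_mul] using (hb p).cone X hX (by rwa [one_mul]))

theorem strictlyLargerCones_of_coneApprox_neg_one
    (hb : ∀ p, ConeApprox (-1) ε (g p) (h p) (b p)) : StrictlyLargerCones g b :=
  fun p X hX hgX => by
    simpa only [neg_one_mul, neg_pos] using
      (hb p).cone X hX (by rwa [neg_one_mul, Left.nonneg_neg_iff])

end ConeComparison

end LorentzApprox

end

open LorentzApprox in
theorem mainTheorem3_general {n : ℕ} {M : Type*} [TopologicalSpace M] [T2Space M]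
    [SigmaCompactSpace M] [ChartedSpace (E n) M] [IsManifold (𝓡 n) ∞ M]
    (g : TensorField n M) (hg_cont : g.IsContinuous) (hg_lor : g.IsLorentzian)
    (h : ContMDiffRiemannianMetric (𝓡 n) ∞ (E n) (fun p : M => TangentSpace (𝓡 n) p)) :
    ∃ gCheck gHat : ℝ → TensorField n M,
      (∀ ε : ℝ, 0 < ε →
        (gCheck ε).IsSmooth ∧ (gCheck ε).IsLorentzian ∧
        (gHat ε).IsSmooth ∧ (gHat ε).IsLorentzian ∧
        StrictlyLargerCones (gCheck ε) g ∧ StrictlyLargerCones g (gHat ε) ∧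
        distWrt h (gCheck ε) g + distWrt h (gHat ε) g < ENNReal.ofReal ε) ∧
      SmoothFamily gCheck ∧ SmoothFamily gHat ∧
      (g.IsC11 →
        ConvergesC1 gCheck g ∧ SecondDerivBounded gCheck ∧
        ConvergesC1 gHat g ∧ SecondDerivBounded gHat) := by
  have hh_cont : TensorField.IsContinuous h.inner := h.contMDiff.continuous
  obtain ⟨gCheck, hCheck_smooth, hCheck, hCheck_C1⟩ :=
    exists_smoothFamily_coneApprox (σ := 1) (by simp) hg_cont hg_lor hh_cont h.pos
  obtain ⟨gHat, hHat_smooth, hHat, hHat_C1⟩ :=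
    exists_smoothFamily_coneApprox (σ := -1) (by simp) hg_cont hg_lor hh_cont h.pos
  refine ⟨gCheck, gHat, fun ε hε => ⟨hCheck_smooth.isSmooth hε,
    fun p => (hCheck ε hε p).isLorentzForm, hHat_smooth.isSmooth hε,
    fun p => (hHat ε hε p).isLorentzForm, strictlyLargerCones_of_coneApprox_one (hCheck ε hε),
    strictlyLargerCones_of_coneApprox_neg_one (hHat ε hε), ?_⟩, hCheck_smooth, hHat_smooth,
    fun hg => ⟨(hCheck_C1 hg).1, (hCheck_C1 hg).2, hHat_C1 hg⟩⟩
  calc distWrt h (gCheck ε) g + distWrt h (gHat ε) g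
      ≤ ENNReal.ofReal (ε / 3) + ENNReal.ofReal (ε / 3) :=
        add_le_add (distWrt_le fun p => (hCheck ε hε p).isCloseWrt)
          (distWrt_le fun p => (hHat ε hε p).isCloseWrt)
    _ = ENNReal.ofReal (ε / 3 + ε / 3) := (ENNReal.ofReal_add (by positivity) (by positivity)).symm
    _ < ENNReal.ofReal ε := (ENNReal.ofReal_lt_ofReal_iff hε).2 (by linarith)

theorem mainTheorem3 {n : ℕ} {M : Type*} [TopologicalSpace M] [T2Space M] [SigmaCompactSpace M]
    [ChartedSpace (LorentzApprox.E n) M] [IsManifold (𝓡 n) ∞ M]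
    (g : LorentzApprox.TensorField n M) (hg_cont : g.IsContinuous) (hg_lor : g.IsLorentzian)
    (hg_time : g.TimeOrientable)
    (h : ContMDiffRiemannianMetric (𝓡 n) ∞ (LorentzApprox.E n)
      (fun p : M => TangentSpace (𝓡 n) p)) :
    ∃ gCheck gHat : ℝ → LorentzApprox.TensorField n M,
      (∀ ε : ℝ, 0 < ε →
        (gCheck ε).IsSmooth ∧ (gCheck ε).IsLorentzian ∧
        (gHat ε).IsSmooth ∧ (gHat ε).IsLorentzian ∧
        LorentzApprox.StrictlyLargerCones (gCheck ε) g ∧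
        LorentzApprox.StrictlyLargerCones g (gHat ε) ∧
        LorentzApprox.distWrt h (gCheck ε) g + LorentzApprox.distWrt h (gHat ε) g
          < ENNReal.ofReal ε) ∧
      LorentzApprox.SmoothFamily gCheck ∧ LorentzApprox.SmoothFamily gHat ∧
      (g.IsC11 →
        LorentzApprox.ConvergesC1 gCheck g ∧ LorentzApprox.SecondDerivBounded gCheck ∧
        LorentzApprox.ConvergesC1 gHat g ∧ LorentzApprox.SecondDerivBounded gHat) :=
  mainTheorem3_general g hg_cont hg_lor h
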